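/- Random recursive trees are grown as follows: start with the root, labelled $1$; for $k\ge 1$ join node $k+1$ to a node chosen uniformly at random among the nodes $1,\dots,k$ already present, independently of the previous choices. Let $\mathbb{V}=\mathbb{N}^\star$, $\mathbb{N}=\{1,2,\dots\}$, be the set of finite words; write $|u|$ for the length of $u\in\mathbb{V}$ and $|u|_1$ for the sum of its entries. Map the root to $\emptyset$, and any other node $j$ to the word $u(j)$ of its direct ancestor extended by the number of nodes $i\le j$ that have the same direct ancestor as $j$. The Harris chain is $X_n=\{u(1),\dots,u(n)\}\subset\mathbb{V}$. Put $\mathrm{TPL}(x)=\sum_{u\in x}|u|$, $\# x(u)=\#\{v\in\mathbb{V}: uv\in x\}$ and $H_n=\sum_{k=1}^n 1/k$. Let $\bar{\mathbb{V}}$ be the set of all finite words over $\mathbb{N}$, all infinite words over $\mathbb{N}$, and all finite words over $\mathbb{N}$ continued by $\infty,\infty,\dots$; let $A_u\subset\bar{\mathbb{V}}$ be the set of elements with prefix $u\in\mathbb{V}$, and equip $\bar{\mathbb V}$ with the $\sigma$-field generated by the sets $A_u$. There is a random probability measure $X_\infty$ on $\bar{\mathbb{V}}$ such that, almost surely, $X_n\to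 X_\infty$ in the Doob–Martin topology, that is, $\frac1n\# X_n(u)\to X_\infty(A_u)$ for all $u\in\mathbb{V}$. Let $X_\infty$ be any such limit. Almost surely, $X_\infty(\{u\})=0$ and $X_\infty(A_u)>0$ for all $u\in\mathbb{V}$; put $\rho(X_\infty,u)=\bigl(X_\infty(A_{ui})/X_\infty(A_u)\bigr)_{i\in\mathbb{N}}$. With $C(s)=1+\sum_{i\ge1}s_i\log s_i$ (where $0\log 0=0$), almost surely the series $C(\rho(X_\infty,u))$ converges absolutely for all $u\in\mathbb{V}$, and $$Y_\infty=\sum_{u\in\mathbb{V}}X_\infty(A_u)\,C(\rho(X_\infty,u)):=\lim_{k\to\infty}\sum_{u\in\mathbb{V},\,|u|_1\le k}X_\infty(A_u)\,C(\rho(X_\infty,u))$$ exists as a limit in $L^p$ for every $0<p<\infty$ (the same limit for all $p$). As $n\to\infty$, $$\frac1n\,\mathrm{TPL}(X_n)-H_n+1\;\to\;Y_\infty\quad\text{almost surely and in }L^p\text{ for every }0<p<\infty.$$ Moreover $E\,\mathrm{TPL}(X_n)=nH_n-n$ for all $n\ge 1$. -/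

import Mathlib

open MeasureTheory ProbabilityTheory Filter Topology
open scoped ENNReal

noncomputable section

/-- Potential tree nodes: finite words over the positive integers (the root is `[]`,
the depth of a node is its length, concatenation is `++`). -/
abbrev Node : Type := List ℕ+

/-- A code of an infinite growing recursive tree, with nodes counted from `0`:
`j k` is the direct ancestor of node `k + 1`, one of the `k + 1` nodes `0, …, k` already present.
The first `n` nodes form a recursive tree with `n` nodes, encoded by `j 0, …, j (n - 2)`. -/
abbrev TreeCode : Type := ∀ k : ℕ, Fin (k + 1)

/-- The word attached to a node of a recursive tree: the word of the direct ancestor, extended by the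
number of nodes up to and including the given one that have the same direct ancestor. -/
def nodeWord (j : TreeCode) : ℕ → Node
  | 0 => []
  | k + 1 =>
      nodeWord j (j k) ++
        ([Nat.toPNat ((Finset.range (k + 1)).filter (fun i => (j i : ℕ) = (j k : ℕ))).card
          (Finset.card_pos.mpr ⟨k, by simp⟩)] : Node)
termination_by n => n
decreasing_by exact (j k).isLt

/-- The Harris tree of the recursive tree formed by the first `n` nodes of `j`. -/
def harrisTree (j : TreeCode) (n : ℕ) : Finset Node :=
  (Finset.range n).image (nodeWord j)

/-- The attachment choices of a random recursive tree chain: each new node chooses its direct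
ancestor uniformly among the nodes of the current tree, independently of the past. -/
structure IsRandomRecursive {Ω : Type*} [MeasurableSpace Ω] (P : Measure Ω)
    (J : ∀ k : ℕ, Ω → Fin (k + 1)) : Prop where
  measurable : ∀ k, Measurable (J k)
  uniform : ∀ (k : ℕ) (i : Fin (k + 1)), P (J k ⁻¹' {i}) = ((k + 1 : ℕ) : ℝ≥0∞)⁻¹
  indep : iIndepFun J P

/-- The Harris chain obtained from random attachment choices: `harrisChain J n ω` has `n` nodes. -/
def harrisChain {Ω : Type*} (J : ∀ k : ℕ, Ω → Fin (k + 1)) (n : ℕ) (ω : Ω) : Finset Node :=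
  harrisTree (fun k => J k ω) n

/-- The total path length, the sum of the depths of all nodes. -/
def totalPathLength (x : Finset Node) : ℕ := ∑ u ∈ x, u.length

/-- The subtree `x(u)` of `x` rooted at `u`, the set of all `v` with `u ++ v ∈ x`. -/
def subtree (x : Finset Node) (u : Node) : Finset Node :=
  x.preimage (fun v => u ++ v) (fun _ _ _ _ h => List.append_cancel_left h)

/-- The enlarged set of nodes: finite words, infinite words, and finite words continued by
`∞, ∞, …` for ever. -/
inductive NodeBar : Type
  | fin (l : Node) : NodeBar
  | inf (s : ℕ → ℕ+) : NodeBar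
  | pad (l : Node) : NodeBar

/-- `u` is a prefix of `v`. -/
def IsPrefixOf (u : Node) : NodeBar → Prop
  | NodeBar.fin l => u <+: l
  | NodeBar.inf s => ∀ (i : ℕ) (h : i < u.length), u[i] = s i
  | NodeBar.pad l => u <+: l

/-- The set `A_u` of all elements of the enlarged node set that have prefix `u`. -/
def cyl (u : Node) : Set NodeBar := {v | IsPrefixOf u v}

/-- The σ-field generated by the sets `A_u`. -/
instance NodeBar.instMeasurableSpace : MeasurableSpace NodeBar :=
  MeasurableSpace.generateFrom (Set.range cyl)

/-- Convergence of finite trees to a probability measure in the Doob-Martin topology, the coarsest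
topology for which all evaluations at the sets `A_u` are continuous. A finite tree `x` is identified
with the uniform distribution on its nodes, which gives `A_u` the mass `#x(u) / #x`. -/
def TendstoDoobMartin (x : ℕ → Finset Node) (μ : ProbabilityMeasure NodeBar) : Prop :=
  ∀ u : Node, Tendsto (fun n => ((subtree (x n) u).card : ℝ) / ((x n).card : ℝ)) atTop
    (𝓝 ((μ : Measure NodeBar).real (cyl u)))

/-- Atom-free and diffuse measures. -/
def IsAtomFreeDiffuse (μ : ProbabilityMeasure NodeBar) : Prop :=
  ∀ u : Node, (μ : Measure NodeBar) {NodeBar.fin u} = 0 ∧ 0 < (μ : Measure NodeBar) (cyl u)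

/-- The relative masses `ρ_i(μ, u) = μ(A_{ui}) / μ(A_u)` of the children of `u`. -/
def rho (μ : ProbabilityMeasure NodeBar) (u : Node) (i : ℕ+) : ℝ :=
  (μ : Measure NodeBar).real (cyl (u ++ [i])) / (μ : Measure NodeBar).real (cyl u)

/-- `C(s) = 1 + ∑ sᵢ log sᵢ`, where `0 log 0 = 0`. -/
def entropyC (s : ℕ+ → ℝ) : ℝ := 1 + ∑' i, s i * Real.log (s i)

/-- `|u|₁`, the sum of the entries of a node. -/
def l1norm (u : Node) : ℕ := (u.map PNat.val).sum

theorem finite_l1norm_le (k : ℕ) : {u : Node | l1norm u ≤ k}.Finite := by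
  have h : {u : Node | l1norm u ≤ k} ⊆
      ⋃ n ∈ Set.Iic k, Set.preimage (List.map PNat.val)
        (Set.range (Composition.blocks (n := n))) := by
    intro u hu
    simp only [Set.mem_iUnion]
    refine ⟨l1norm u, hu, ⟨u.map PNat.val, ?_, rfl⟩, rfl⟩
    intro i hi
    obtain ⟨a, -, rfl⟩ := List.mem_map.mp hi
    exact a.pos
  refine ((Set.finite_Iic k).biUnion fun n _ => ?_).subset h
  exact (Set.finite_range _).preimage
    (List.map_injective_iff.mpr PNat.coe_injective).injOn

/-- The finite set of nodes `u` with `|u|₁ ≤ k`. -/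
def nodesUpTo (k : ℕ) : Finset Node := (finite_l1norm_le k).toFinset

/-- The partial sum `∑_{|u|₁ ≤ k} μ(A_u) C(ρ(μ, u))`. -/
def partialSum (μ : ProbabilityMeasure NodeBar) (k : ℕ) : ℝ :=
  ∑ u ∈ nodesUpTo k, (μ : Measure NodeBar).real (cyl u) * entropyC (rho μ u)

end

/-! Let `S_v` be the size of the subtree of node `v` in the tree with `n = m + 1` nodes. Since `∑
S_v = TPL + n`, and since the terms `S H(S)` telescope along the edges, the centred path length `TPL
- n H_n + n` is the sum over all nodes `v` of `nodeTerm`, namely `S_v - S_v H(S_v) + ∑ S_c H(S_c)`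
with `c` running through the children of `v`. Divided by `n`, each such term is a martingale that
starts from `0` when `v` is born. Hence the sum over any set of words, divided by `n`, is a centred
martingale (`stepAvg_outerSum_div`). For the full sum this yields the mean of the path length.

Limit of one term. Subtree sizes form Pólya urns, so `S_v / n` converges to a limit `x_v`, positive
because `H_m - H(S_v - 1)` is a nonnegative martingale and therefore stays bounded
(`ae_exists_mass`). As `H_n - log n` converges, the term of `v` should tend to `x_v C(ρ)`. The
exchange of the limit with the sum over infinitely many children rests on a bound for the mean
contribution of late children and Fatou's lemma (`ae_hasSum_children`). The masses `x_v` are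
consistent, which also gives the measure `X_∞`, as an image of the uniform distribution.

Uniform smallness of the tail. If node `m + 1` is attached to `p`, then the sum over any set of
words moves by at most `(depth p + 1)(1 + H_{m+1})`, as only ancestors of `p` matter. Exponential
moments of the depth turn this into a recursion for even moments, `e (m + 1) ≤ (1 + C w) e m + C w`
with the summable weights `w = (m + 1) ^ (-3/2)` (`stepAvg_outerSum_pow_le`). A word of a node `v`
has `|u|₁ ≤ v`, so the sum over the words with `|u|₁ > k` vanishes up to time `k`; its moments are
then bounded, uniformly in time, by a quantity that tends to `0` as `k → ∞`
(`exists_integral_outerSum_pow_le`).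

Conclusion. The full martingale is bounded in `L²` and converges to some `Y`; the part with `|u|₁ >
k` converges to `Y` minus the partial sum, which is small in `L^p` by Fatou. Moments of higher order
give uniform integrability and thereby convergence in `L^p`. -/

set_option linter.unusedSectionVars false

namespace RecursiveTree

/-! ### Combinatorics of growing trees: ancestors, subtree sizes, words -/

/-- The indicator that node `i` is an ancestor of node `k`, or `k` itself. -/
def anc (j : TreeCode) (i : ℕ) : ℕ → ℕ
  | 0 => if i = 0 then 1 else 0
  | k + 1 => if i = k + 1 then 1 else anc j i (j k)
termination_by k => k
decreasing_by exact (j k).isLt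

/-- The number of nodes in the subtree rooted at `i`, among the nodes `0, …, m`. -/
def subtreeSize (j : TreeCode) (i m : ℕ) : ℕ := ∑ k ∈ Finset.range (m + 1), anc j i k

/-- The depth of node `k`. -/
def depth (j : TreeCode) (k : ℕ) : ℕ := (nodeWord j k).length

variable {j j' : TreeCode}

theorem anc_zero (i : ℕ) : anc j i 0 = if i = 0 then 1 else 0 := by rw [anc]

theorem anc_succ (i k : ℕ) : anc j i (k + 1) = if i = k + 1 then 1 else anc j i (j k) := by
  rw [anc]

theorem nodeWord_zero : nodeWord j 0 = [] := by rw [nodeWord]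

theorem nodeWord_succ (k : ℕ) : nodeWord j (k + 1) = nodeWord j (j k) ++
    ([Nat.toPNat ((Finset.range (k + 1)).filter (fun i => (j i : ℕ) = (j k : ℕ))).card
      (Finset.card_pos.mpr ⟨k, by simp⟩)] : Node) := by
  rw [nodeWord]

/-- This lemma and its analogues below provide adaptedness: `Function.update j m` leaves the tree on
the nodes `0, …, m` unchanged. -/
theorem anc_congr (i : ℕ) {k : ℕ} (h : ∀ l < k, j l = j' l) : anc j i k = anc j' i k := by
  induction k using Nat.strong_induction_on with
  | _ k ih =>
    cases k with
    | zero => simp [anc_zero]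
    | succ k =>
      have hk := h k (Nat.lt_succ_self k)
      rw [anc_succ, anc_succ, ← hk, ih (j k) (j k).isLt
        fun l hl => h l (hl.trans (j k).isLt)]

theorem nodeWord_congr {k : ℕ} (h : ∀ l < k, j l = j' l) : nodeWord j k = nodeWord j' k := by
  induction k using Nat.strong_induction_on with
  | _ k ih =>
    cases k with
    | zero => simp [nodeWord_zero]
    | succ k =>
      have hk := h k (Nat.lt_succ_self k)
      have hf : (Finset.range (k + 1)).filter (fun i => (j i : ℕ) = (j k : ℕ)) =
          (Finset.range (k + 1)).filter (fun i => (j' i : ℕ) = (j' k : ℕ)) := by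
        apply Finset.filter_congr
        intro i hi
        rw [h i (Finset.mem_range.mp hi), hk]
      rw [nodeWord_succ, nodeWord_succ, ih (j k) (j k).isLt
        fun l hl => h l (hl.trans (j k).isLt)]
      congr 2
      · rw [hk]
      · exact PNat.eq (congrArg Finset.card hf)

theorem subtreeSize_congr (i : ℕ) {m : ℕ} (h : ∀ l < m, j l = j' l) :
    subtreeSize j i m = subtreeSize j' i m :=
  Finset.sum_congr rfl fun _ hk => anc_congr i fun l hl =>
    h l (hl.trans_le (Nat.lt_succ_iff.mp (Finset.mem_range.mp hk)))

theorem depth_zero : depth j 0 = 0 := by simp [depth, nodeWord_zero]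

theorem depth_succ (k : ℕ) : depth j (k + 1) = depth j (j k) + 1 := by
  simp [depth, nodeWord_succ]

theorem depth_congr {k : ℕ} (h : ∀ l < k, j l = j' l) : depth j k = depth j' k := by
  rw [depth, depth, nodeWord_congr h]

theorem anc_eq_zero_of_lt {i k : ℕ} (h : k < i) : anc j i k = 0 := by
  induction k using Nat.strong_induction_on with
  | _ k ih =>
    cases k with
    | zero => simp [anc_zero]; omega
    | succ k =>
      rw [anc_succ, if_neg (by omega)]
      exact ih _ (j k).isLt (by have := (j k).isLt; omega)

theorem anc_self (i : ℕ) : anc j i i = 1 := by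
  cases i <;> simp [anc_zero, anc_succ]

theorem anc_le_one (i k : ℕ) : anc j i k ≤ 1 := by
  induction k using Nat.strong_induction_on with
  | _ k ih =>
    cases k with
    | zero => rw [anc_zero]; split_ifs <;> simp
    | succ k =>
      rw [anc_succ]
      split_ifs
      · exact le_rfl
      · exact ih _ (j k).isLt

theorem anc_root (k : ℕ) : anc j 0 k = 1 := by
  induction k using Nat.strong_induction_on with
  | _ k ih =>
    cases k with
    | zero => simp [anc_zero]
    | succ k =>
      rw [anc_succ, if_neg (by omega)]
      exact ih _ (j k).isLt

/-- A node at depth `d` has `d + 1` ancestors, itself included. Double counting then relates the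
total path length to the sum of all subtree sizes. -/
theorem sum_anc {m k : ℕ} (hk : k ≤ m) :
    ∑ i ∈ Finset.range (m + 1), anc j i k = depth j k + 1 := by
  induction k using Nat.strong_induction_on with
  | _ k ih =>
    cases k with
    | zero => simp [anc_zero, depth_zero]
    | succ k =>
      have h1 := (j k).isLt
      have h2 : ∀ i, anc j i (k + 1) = (if i = k + 1 then 1 else 0) + anc j i (j k) := by
        intro i
        rw [anc_succ]
        split_ifs with h
        · rw [anc_eq_zero_of_lt (by omega)]
        · simp
      simp_rw [h2]
      rw [Finset.sum_add_distrib, ih _ h1 (by omega), depth_succ, Finset.sum_ite_eq',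
        if_pos (Finset.mem_range.mpr (by omega))]
      ring

/-- A descendant of `v` is `v` itself or a descendant of exactly one child of `v`. -/
theorem sum_children_anc (v : ℕ) {m k : ℕ} (hk : k ≤ m) :
    ∑ l ∈ Finset.range m, (if (j l : ℕ) = v then anc j (l + 1) k else 0) +
      (if k = v then 1 else 0) = anc j v k := by
  induction k using Nat.strong_induction_on with
  | _ k ih =>
    cases k with
    | zero =>
      simp [anc_zero, eq_comm]
    | succ k =>
      have h1 := (j k).isLt
      have h2 : ∀ l, (if (j l : ℕ) = v then anc j (l + 1) (k + 1) else 0) =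
          (if l = k then (if (j k : ℕ) = v then 1 else 0) else 0) +
            (if (j l : ℕ) = v then anc j (l + 1) (j k) else 0) := by
        intro l
        rw [anc_succ]
        by_cases h : l = k
        · subst h
          rw [anc_eq_zero_of_lt (show (j l : ℕ) < l + 1 by omega)]
          simp
        · simp [h]
      have h3 := ih (j k) h1 (by omega)
      simp_rw [h2]
      rw [Finset.sum_add_distrib, Finset.sum_ite_eq', if_pos (Finset.mem_range.mpr (by omega)),
        anc_succ]
      by_cases hv : v = k + 1
      · subst hv
        rw [anc_eq_zero_of_lt (show (j k : ℕ) < k + 1 by omega)] at h3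
        have h4 : (j k : ℕ) ≠ k + 1 := by omega
        simp only [if_neg h4] at h3
        simp [h4]
        simpa using h3
      · rw [if_neg (show ¬ k + 1 = v from fun h => hv h.symm), if_neg hv, ← h3]
        ring

theorem subtreeSize_succ {i m : ℕ} :
    subtreeSize j i (m + 1) = subtreeSize j i m + anc j i (m + 1) := by
  rw [subtreeSize, Finset.sum_range_succ, subtreeSize]

theorem subtreeSize_succ_of_le {i m : ℕ} (h : i ≤ m) :
    subtreeSize j i (m + 1) = subtreeSize j i m + anc j i (j m) := by
  rw [subtreeSize_succ, anc_succ, if_neg (by omega)]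

theorem subtreeSize_self (i : ℕ) : subtreeSize j i i = 1 := by
  rw [subtreeSize, Finset.sum_range_succ, anc_self, Finset.sum_eq_zero]
  intro k hk
  exact anc_eq_zero_of_lt (Finset.mem_range.mp hk)

theorem one_le_subtreeSize {i m : ℕ} (h : i ≤ m) : 1 ≤ subtreeSize j i m := by
  refine (anc_self (j := j) i).symm.le.trans ?_
  exact Finset.single_le_sum (f := fun k => anc j i k) (fun _ _ => Nat.zero_le _)
    (Finset.mem_range.mpr (Nat.lt_succ_of_le h))

theorem subtreeSize_le (i m : ℕ) : subtreeSize j i m ≤ m + 1 := by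
  calc subtreeSize j i m ≤ ∑ k ∈ Finset.range (m + 1), 1 :=
        Finset.sum_le_sum fun k _ => anc_le_one i k
    _ = m + 1 := by simp

theorem subtreeSize_root (m : ℕ) : subtreeSize j 0 m = m + 1 := by
  simp [subtreeSize, anc_root]

theorem sum_children_subtreeSize {v m : ℕ} (hv : v ≤ m) :
    ∑ l ∈ Finset.range m, (if (j l : ℕ) = v then subtreeSize j (l + 1) m else 0) + 1 =
      subtreeSize j v m := by
  have h : ∀ k ∈ Finset.range (m + 1), anc j v k =
      ∑ l ∈ Finset.range m, (if (j l : ℕ) = v then anc j (l + 1) k else 0) +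
      (if k = v then 1 else 0) := fun k hk =>
    (sum_children_anc v (Nat.lt_succ_iff.mp (Finset.mem_range.mp hk))).symm
  rw [subtreeSize, Finset.sum_congr rfl h, Finset.sum_add_distrib, Finset.sum_ite_eq',
    if_pos (Finset.mem_range.mpr (by omega)), Finset.sum_comm]
  congr 1
  refine Finset.sum_congr rfl fun l _ => ?_
  split_ifs <;> simp [subtreeSize]

/-- Deleting the last letter gives the word of the parent, so by induction equal words have equal
parents; among the children of one parent the last letter strictly increases with time. -/
theorem nodeWord_injective (j : TreeCode) : Function.Injective (nodeWord j) := by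
  have key : ∀ N a b, a ≤ N → b ≤ N → nodeWord j a = nodeWord j b → a = b := by
    intro N
    induction N with
    | zero => intro a b ha hb _; omega
    | succ N ih =>
      intro a b ha hb h
      cases a with
      | zero =>
        cases b with
        | zero => rfl
        | succ b => simp [nodeWord_zero, nodeWord_succ] at h
      | succ a =>
        cases b with
        | zero => simp [nodeWord_zero, nodeWord_succ] at h
        | succ b =>
          rw [nodeWord_succ, nodeWord_succ] at h
          obtain ⟨h1, h2⟩ := List.append_inj' h rfl
          have ha' := (j a).isLt
          have hb' := (j b).isLt
          have h3 := ih _ _ (by omega) (by omega) h1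
          have h4 : ((Finset.range (a + 1)).filter (fun i => (j i : ℕ) = (j a : ℕ))).card =
              ((Finset.range (b + 1)).filter (fun i => (j i : ℕ) = (j b : ℕ))).card := by
            have := congrArg PNat.val (List.cons.inj h2).1
            exact this
          have mono : ∀ a b : ℕ, a < b → (j a : ℕ) = j b →
              ((Finset.range (a + 1)).filter (fun i => (j i : ℕ) = (j a : ℕ))).card <
              ((Finset.range (b + 1)).filter (fun i => (j i : ℕ) = (j b : ℕ))).card := by
            intro a b hab hj
            apply Finset.card_lt_card
            rw [Finset.ssubset_iff_of_subset]
            · exact ⟨b, by simp, by simp; omega⟩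
            · intro i hi
              simp only [Finset.mem_filter, Finset.mem_range] at hi ⊢
              exact ⟨by omega, by rw [hi.2, hj]⟩
          rcases lt_trichotomy a b with hab | hab | hab
          · have := mono a b hab h3; omega
          · rw [hab]
          · have := mono b a hab h3.symm; omega
  exact fun a b h => key (max a b) a b (le_max_left _ _) (le_max_right _ _) h

theorem anc_eq_ite (i k : ℕ) : anc j i k = if nodeWord j i <+: nodeWord j k then 1 else 0 := by
  induction k using Nat.strong_induction_on with
  | _ k ih =>
    cases k with
    | zero =>
      rw [anc_zero, nodeWord_zero]
      congr 1
      rw [List.prefix_nil, ← nodeWord_zero (j := j), (nodeWord_injective j).eq_iff]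
    | succ k =>
      rw [anc_succ, ih _ (j k).isLt]
      have : nodeWord j i <+: nodeWord j (k + 1) ↔ i = k + 1 ∨ nodeWord j i <+: nodeWord j (j k) := by
        rw [← (nodeWord_injective j).eq_iff (a := i), nodeWord_succ, List.prefix_concat_iff]
      simp only [this]
      split_ifs <;> simp_all

theorem card_subtree_harrisTree (j : TreeCode) (i m : ℕ) :
    (subtree (harrisTree j (m + 1)) (nodeWord j i)).card = subtreeSize j i m := by
  classical
  have h : (subtree (harrisTree j (m + 1)) (nodeWord j i)).image (fun v => nodeWord j i ++ v) =
      ((Finset.range (m + 1)).filter (fun k => nodeWord j i <+: nodeWord j k)).image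
        (nodeWord j) := by
    ext w
    simp only [subtree, harrisTree, Finset.mem_image, Finset.mem_preimage, Finset.mem_filter]
    constructor
    · rintro ⟨v, ⟨k, hk, hkv⟩, rfl⟩
      exact ⟨k, ⟨hk, hkv ▸ List.prefix_append _ _⟩, hkv⟩
    · rintro ⟨k, ⟨hk, ⟨v, hv⟩⟩, rfl⟩
      exact ⟨v, ⟨k, hk, hv.symm⟩, hv⟩
  rw [← Finset.card_image_of_injective _ (List.append_right_injective (nodeWord j i)), h,
    Finset.card_image_of_injective _ (nodeWord_injective j), Finset.card_filter, subtreeSize]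
  exact Finset.sum_congr rfl fun k _ => (anc_eq_ite i k).symm

theorem card_harrisTree (j : TreeCode) (n : ℕ) : (harrisTree j n).card = n := by
  rw [harrisTree, Finset.card_image_of_injective _ (nodeWord_injective j), Finset.card_range]

theorem totalPathLength_harrisTree (j : TreeCode) (n : ℕ) :
    totalPathLength (harrisTree j n) = ∑ k ∈ Finset.range n, depth j k := by
  rw [totalPathLength, harrisTree, Finset.sum_image (fun _ _ _ _ h => nodeWord_injective j h)]
  rfl

/-- The siblings of node `k + 1` counted by its last letter were attached at indices between the
parent `p` and `k`, so this letter is at most `k + 1 - p`, and the word of `p` contributes at most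
`p`. Words with large `|u|₁` therefore appear late. -/
theorem l1norm_nodeWord_le (j : TreeCode) (k : ℕ) : l1norm (nodeWord j k) ≤ k := by
  induction k using Nat.strong_induction_on with
  | _ k ih =>
    cases k with
    | zero => simp [nodeWord_zero, l1norm]
    | succ k =>
      have h1 := ih _ (j k).isLt
      have h2 : ((Finset.range (k + 1)).filter (fun i => (j i : ℕ) = (j k : ℕ))).card
          ≤ k + 1 - j k := by
        have : (Finset.range (k + 1)).filter (fun i => (j i : ℕ) = (j k : ℕ)) ⊆
            Finset.Ico (j k : ℕ) (k + 1) := by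
          intro i hi
          simp only [Finset.mem_filter, Finset.mem_range, Finset.mem_Ico] at hi ⊢
          have := (j i).isLt
          omega
        simpa using Finset.card_le_card this
      have h3 := (j k).isLt
      rw [nodeWord_succ]
      simp only [l1norm, List.map_append, List.sum_append, List.map_cons, List.map_nil,
        List.sum_cons, List.sum_nil] at h1 ⊢
      have h4 : PNat.val (Nat.toPNat
        ((Finset.range (k + 1)).filter (fun i => (j i : ℕ) = (j k : ℕ))).card
        (Finset.card_pos.mpr ⟨k, by simp⟩)) =
        ((Finset.range (k + 1)).filter (fun i => (j i : ℕ) = (j k : ℕ))).card := rfl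
      rw [h4]
      omega

/-- If every node has infinitely many children then every word occurs. -/
theorem nodeWord_surjective (h : ∀ p : ℕ, {k : ℕ | (j k : ℕ) = p}.Infinite) :
    Function.Surjective (nodeWord j) := by
  intro u
  induction u using List.reverseRecOn with
  | nil => exact ⟨0, nodeWord_zero⟩
  | append_singleton u r ih =>
    obtain ⟨p, rfl⟩ := ih
    -- Letters count from `1` and `Nat.nth` from `0`: node `k + 1` is the child number `r` of `p`.
    set k := Nat.nth (fun k => (j k : ℕ) = p) ((r : ℕ) - 1) with hk
    have h1 : (j k : ℕ) = p := Nat.nth_mem_of_infinite (h p) _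
    have h2 : Nat.count (fun k => (j k : ℕ) = p) k = (r : ℕ) - 1 :=
      Nat.count_nth_of_infinite (h p) _
    refine ⟨k + 1, ?_⟩
    have h3 : ((Finset.range (k + 1)).filter (fun i => (j i : ℕ) = (j k : ℕ))).card = r := by
      rw [h1]
      rw [← Nat.count_eq_card_filter_range, Nat.count_succ, h2, if_pos h1]
      have := r.pos
      omega
    rw [nodeWord_succ]
    congr 2
    exact PNat.eq h3

/-! ### Harmonic numbers, one-step averages and Pólya urns -/

variable {j j' : TreeCode}

/-- The harmonic numbers, as real numbers. -/
noncomputable def harm (n : ℕ) : ℝ := (harmonic n : ℝ)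

theorem harm_zero : harm 0 = 0 := by simp [harm]

theorem harm_one : harm 1 = 1 := by simp [harm, harmonic]

theorem harm_succ (n : ℕ) : harm (n + 1) = harm n + 1 / ((n : ℝ) + 1) := by
  simp [harm, harmonic_succ]

theorem harm_mono : Monotone harm := monotone_nat_of_le_succ fun n => by
  rw [harm_succ]
  have : (0 : ℝ) ≤ 1 / ((n : ℝ) + 1) := by positivity
  linarith

theorem harm_nonneg (n : ℕ) : 0 ≤ harm n := harm_zero ▸ harm_mono (Nat.zero_le n)

/-- The average of `G` over the possible values of the coordinate `m`, which is the expected value of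
`G` after attaching node `m + 1`, given the tree on the nodes `0, …, m`. -/
noncomputable def stepAvg (m : ℕ) (G : TreeCode → ℝ) (j : TreeCode) : ℝ :=
  (∑ i : Fin (m + 1), G (Function.update j m i)) / ((m : ℝ) + 1)

theorem update_apply_of_lt {m l : ℕ} (h : l < m) (i : Fin (m + 1)) :
    Function.update j m i l = j l := Function.update_of_ne h.ne _ _

theorem stepAvg_eq {m : ℕ} {G : TreeCode → ℝ} (g : ℕ → ℝ)
    (h : ∀ i : Fin (m + 1), G (Function.update j m i) = g i) :
    stepAvg m G j = (∑ p ∈ Finset.range (m + 1), g p) / ((m : ℝ) + 1) := by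
  rw [stepAvg, Finset.sum_range]
  simp_rw [h]

theorem stepAvg_const_mul (m : ℕ) (c : ℝ) (G : TreeCode → ℝ) :
    stepAvg m (fun j => c * G j) j = c * stepAvg m G j := by
  simp only [stepAvg, ← Finset.mul_sum, mul_div_assoc]

/-- Functions of the composition of a Pólya urn that are harmonic: `a m B` is the value when the
subtree under observation has `B` of the `m + 1` nodes. -/
structure IsUrnHarmonic (a : ℕ → ℕ → ℝ) : Prop where
  harmonic : ∀ m B : ℕ, 1 ≤ B → B ≤ m + 1 →
    (B / ((m : ℝ) + 1)) * a (m + 1) (B + 1) + (1 - B / ((m : ℝ) + 1)) * a (m + 1) B = a m B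
  nonneg : ∀ m B : ℕ, 1 ≤ B → B ≤ m + 1 → 0 ≤ a m B

/-- Of the `m + 1` equally likely parents exactly `B` lie in the subtree, so its size evolves as a
Pólya urn and `a` along it is a martingale. -/
theorem IsUrnHarmonic.avg {a : ℕ → ℕ → ℝ} (ha : IsUrnHarmonic a) {i m : ℕ} (hi : i ≤ m) :
    (∑ p ∈ Finset.range (m + 1), a (m + 1) (subtreeSize j i m + anc j i p)) / ((m : ℝ) + 1) =
      a m (subtreeSize j i m) := by
  have hm : (m : ℝ) + 1 ≠ 0 := by positivity
  set B := subtreeSize j i m with hB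
  have h1 : ∀ p, a (m + 1) (B + anc j i p) =
      (anc j i p : ℝ) * (a (m + 1) (B + 1) - a (m + 1) B) + a (m + 1) B := by
    intro p
    have := anc_le_one (j := j) i p
    interval_cases h : anc j i p <;> simp
  simp_rw [h1]
  rw [Finset.sum_add_distrib, ← Finset.sum_mul, ← Nat.cast_sum,
    show ∑ p ∈ Finset.range (m + 1), anc j i p = B from rfl,
    ← ha.harmonic m B (one_le_subtreeSize hi) (subtreeSize_le _ _)]
  simp
  field_simp
  ring

theorem subtreeSize_update {i m : ℕ} (hi : i ≤ m) (p : Fin (m + 1)) :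
    subtreeSize (Function.update j m p) i (m + 1) = subtreeSize j i m + anc j i p := by
  rw [subtreeSize_succ_of_le hi, Function.update_self,
    subtreeSize_congr i fun l hl => update_apply_of_lt hl p,
    anc_congr i fun l hl => update_apply_of_lt (hl.trans_le (Nat.lt_succ_iff.mp p.isLt)) p]

theorem IsUrnHarmonic.stepAvg {a : ℕ → ℕ → ℝ} (ha : IsUrnHarmonic a) {i m : ℕ} (hi : i ≤ m) :
    stepAvg m (fun j => a (m + 1) (subtreeSize j i (m + 1))) j = a m (subtreeSize j i m) := by
  rw [stepAvg_eq (fun p => a (m + 1) (subtreeSize j i m + anc j i p)), ha.avg hi]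
  intro p
  rw [subtreeSize_update hi]

/-- The sum of `a` over the subtrees of the children of `v` that are attached from time `L` on. -/
noncomputable def childSum (a : ℕ → ℕ → ℝ) (v L m : ℕ) (j : TreeCode) : ℝ :=
  ∑ l ∈ Finset.Ico L m, if (j l : ℕ) = v then a m (subtreeSize j (l + 1) m) else 0

theorem childSum_nonneg {a : ℕ → ℕ → ℝ} (ha : IsUrnHarmonic a) (v L m : ℕ) (j : TreeCode) :
    0 ≤ childSum a v L m j := by
  refine Finset.sum_nonneg fun l hl => ?_
  split_ifs
  · exact ha.nonneg _ _ (one_le_subtreeSize (Finset.mem_Ico.mp hl).2) (subtreeSize_le _ _)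
  · exact le_rfl

theorem childSum_congr (a : ℕ → ℕ → ℝ) (v L : ℕ) {m : ℕ} (h : ∀ l < m, j l = j' l) :
    childSum a v L m j = childSum a v L m j' := by
  refine Finset.sum_congr rfl fun l hl => ?_
  rw [subtreeSize_congr _ h, h l (Finset.mem_Ico.mp hl).2]

/-- Existing child subtrees contribute martingales, and with probability `1 / (m + 1)` a new child
of size `1` is born. The drift is thus deterministic and nonnegative. -/
theorem stepAvg_childSum {a : ℕ → ℕ → ℝ} (ha : IsUrnHarmonic a) {v L m : ℕ} (hv : v ≤ m)
    (hL : L ≤ m) :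
    stepAvg m (childSum a v L (m + 1)) j =
      childSum a v L m j + a (m + 1) 1 / ((m : ℝ) + 1) := by
  rw [stepAvg_eq (fun p => ∑ l ∈ Finset.Ico L m, (if (j l : ℕ) = v then
    a (m + 1) (subtreeSize j (l + 1) m + anc j (l + 1) p) else 0) +
    if p = v then a (m + 1) 1 else 0)]
  · rw [Finset.sum_add_distrib, Finset.sum_ite_eq', if_pos (Finset.mem_range.mpr (by omega)),
      add_div, Finset.sum_comm, Finset.sum_div, childSum]
    congr 1
    refine Finset.sum_congr rfl fun l hl => ?_
    split_ifs with h
    · exact ha.avg (Finset.mem_Ico.mp hl).2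
    · simp
  · intro p
    rw [childSum, Finset.sum_Ico_succ_top hL, Function.update_self, subtreeSize_self]
    congr 1
    refine Finset.sum_congr rfl fun l hl => ?_
    have hl := (Finset.mem_Ico.mp hl).2
    rw [update_apply_of_lt hl, subtreeSize_update hl]

/-! ### Splitting the centred path length over the nodes -/

/-- The contribution of the node `v` to the centred total path length of the tree on `0, …, m`. -/
noncomputable def nodeTerm (j : TreeCode) (v m : ℕ) : ℝ :=
  subtreeSize j v m - subtreeSize j v m * harm (subtreeSize j v m) +
    ∑ l ∈ Finset.range m, if (j l : ℕ) = v then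
      subtreeSize j (l + 1) m * harm (subtreeSize j (l + 1) m) else 0

/-- The increment of `nodeTerm` if node `m + 1` is attached to `p`. -/
noncomputable def nodeIncr (j : TreeCode) (v p m : ℕ) : ℝ :=
  anc j v p * (1 - harm (subtreeSize j v m)) +
    ∑ l ∈ Finset.range m, if (j l : ℕ) = v then
      anc j (l + 1) p * harm (subtreeSize j (l + 1) m) else 0

theorem nodeTerm_congr (v : ℕ) {m : ℕ} (h : ∀ l < m, j l = j' l) :
    nodeTerm j v m = nodeTerm j' v m := by
  rw [nodeTerm, nodeTerm, subtreeSize_congr _ h]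
  congr 1
  refine Finset.sum_congr rfl fun l hl => ?_
  rw [subtreeSize_congr _ h, h l (Finset.mem_range.mp hl)]

theorem nodeIncr_congr (v : ℕ) {p m : ℕ} (hp : p ≤ m) (h : ∀ l < m, j l = j' l) :
    nodeIncr j v p m = nodeIncr j' v p m := by
  have hp' : ∀ l < p, j l = j' l := fun l hl => h l (hl.trans_le hp)
  rw [nodeIncr, nodeIncr, subtreeSize_congr _ h, anc_congr _ hp']
  congr 1
  refine Finset.sum_congr rfl fun l hl => ?_
  rw [subtreeSize_congr _ h, h l (Finset.mem_range.mp hl), anc_congr _ hp']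

/-- At birth `v` is a leaf, with value `1 - H_1 = 0`. New nodes therefore do not disturb the
martingale property of sums over all present nodes. -/
theorem nodeTerm_self (v : ℕ) : nodeTerm j v v = 0 := by
  rw [nodeTerm, subtreeSize_self, Finset.sum_eq_zero]
  · simp [harm_one]
  · intro l hl
    have := (j l).isLt
    rw [if_neg]
    have := Finset.mem_range.mp hl
    omega

/-- The increment of `B H_B` is exactly `H_B + 1`. This exactness is the reason for working with
harmonic numbers instead of logarithms. -/
theorem mul_harm_succ (B : ℕ) :
    ((B + 1 : ℕ) : ℝ) * harm (B + 1) = B * harm B + (harm B + 1) := by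
  have : (B : ℝ) + 1 ≠ 0 := by positivity
  rw [harm_succ]
  push_cast
  field_simp
  ring

theorem mul_harm_add_anc (i p B : ℕ) :
    ((B + anc j i p : ℕ) : ℝ) * harm (B + anc j i p) =
      B * harm B + anc j i p * (harm B + 1) := by
  have := anc_le_one (j := j) i p
  interval_cases h : anc j i p
  · simp
  · rw [mul_harm_succ]; simp

theorem nodeTerm_succ {v m : ℕ} (hv : v ≤ m) :
    nodeTerm j v (m + 1) = nodeTerm j v m + nodeIncr j v (j m) m := by
  -- The constants `+ 1` in the increments of `B H_B`, together with the value `H_1 = 1` of a new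
  -- child of `v`, add up by this identity.
  have h1 := sum_children_anc (j := j) v (Nat.lt_succ_iff.mp (j m).isLt)
  have h2 : ((∑ l ∈ Finset.range m, (if (j l : ℕ) = v then (anc j (l + 1) (j m) : ℝ) else 0)) +
      (if (j m : ℕ) = v then 1 else 0)) = anc j v (j m) := by
    rw [← h1]; push_cast; rfl
  rw [nodeTerm, nodeTerm, nodeIncr, Finset.sum_range_succ, subtreeSize_self,
    subtreeSize_succ_of_le hv, mul_harm_add_anc]
  have h3 : ∑ l ∈ Finset.range m, (if (j l : ℕ) = v then
      (subtreeSize j (l + 1) (m + 1) : ℝ) * harm (subtreeSize j (l + 1) (m + 1)) else 0) =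
      ∑ l ∈ Finset.range m, (if (j l : ℕ) = v then
        (subtreeSize j (l + 1) m : ℝ) * harm (subtreeSize j (l + 1) m) else 0) +
      ∑ l ∈ Finset.range m, (if (j l : ℕ) = v then
        (anc j (l + 1) (j m) : ℝ) * harm (subtreeSize j (l + 1) m) else 0) +
      ∑ l ∈ Finset.range m, (if (j l : ℕ) = v then (anc j (l + 1) (j m) : ℝ) else 0) := by
    rw [← Finset.sum_add_distrib, ← Finset.sum_add_distrib]
    refine Finset.sum_congr rfl fun l hl => ?_
    have hl := Finset.mem_range.mp hl
    split_ifs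
    · rw [subtreeSize_succ_of_le (show l + 1 ≤ m from hl), mul_harm_add_anc]
      ring
    · simp
  rw [h3, harm_one]
  by_cases hj : (j m : ℕ) = v
  · rw [if_pos hj] at h2 ⊢
    push_cast
    linear_combination h2
  · rw [if_neg hj] at h2 ⊢
    push_cast
    linear_combination h2

/-- The increment is linear in the ancestor indicators of `p`, and these sum to subtree sizes. The
mean increment is thus `nodeTerm / (m + 1)`, which makes `nodeTerm / (m + 1)` a martingale. -/
theorem sum_nodeIncr (v m : ℕ) :
    ∑ p ∈ Finset.range (m + 1), nodeIncr j v p m = nodeTerm j v m := by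
  simp only [nodeIncr, nodeTerm]
  rw [Finset.sum_add_distrib, ← Finset.sum_mul, ← Nat.cast_sum, Finset.sum_comm]
  rw [show ∑ p ∈ Finset.range (m + 1), anc j v p = subtreeSize j v m from rfl]
  congr 1
  · ring
  · refine Finset.sum_congr rfl fun l _ => ?_
    split_ifs
    · rw [← Finset.sum_mul, ← Nat.cast_sum]
      rfl
    · simp

/-- Nothing changes unless `v` is an ancestor of `p`, and `p` lies below at most one child of `v`,
so at most one harmonic number survives in the sum. -/
theorem abs_nodeIncr_le (v : ℕ) {p m : ℕ} (hp : p ≤ m) :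
    |nodeIncr j v p m| ≤ anc j v p * (1 + harm (m + 1)) := by
  have hB : ∀ i, harm (subtreeSize j i m) ≤ harm (m + 1) := fun i =>
    harm_mono (subtreeSize_le i m)
  have h0 : 0 ≤ ∑ l ∈ Finset.range m, (if (j l : ℕ) = v then
      (anc j (l + 1) p : ℝ) * harm (subtreeSize j (l + 1) m) else 0) := by
    refine Finset.sum_nonneg fun l _ => ?_
    have := harm_nonneg (subtreeSize j (l + 1) m)
    split_ifs <;> positivity
  have h1 : ∑ l ∈ Finset.range m, (if (j l : ℕ) = v then
      (anc j (l + 1) p : ℝ) * harm (subtreeSize j (l + 1) m) else 0) ≤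
      anc j v p * harm (m + 1) := by
    have h2 := sum_children_anc (j := j) v hp
    have h3 : ∑ l ∈ Finset.range m, (if (j l : ℕ) = v then (anc j (l + 1) p : ℝ) else 0) ≤
        anc j v p := by
      rw [← h2]
      push_cast
      have : (0 : ℝ) ≤ if p = v then 1 else 0 := by split_ifs <;> simp
      linarith
    refine le_trans ?_ (mul_le_mul_of_nonneg_right h3 (harm_nonneg _))
    rw [Finset.sum_mul]
    refine Finset.sum_le_sum fun l _ => ?_
    split_ifs
    · exact mul_le_mul_of_nonneg_left (hB _) (by positivity)
    · simp
  have h4 := mul_le_mul_of_nonneg_left (hB v) (Nat.cast_nonneg (α := ℝ) (anc j v p))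
  have h5 := mul_nonneg (Nat.cast_nonneg (α := ℝ) (anc j v p)) (harm_nonneg (subtreeSize j v m))
  have h6 := Nat.cast_nonneg (α := ℝ) (anc j v p)
  rw [nodeIncr, abs_le]
  constructor <;> nlinarith

open Classical in
/-- The sum of the contributions of all nodes outside the set `t`. -/
noncomputable def outerSum (t : Set Node) (m : ℕ) (j : TreeCode) : ℝ :=
  ∑ v ∈ Finset.range (m + 1), if nodeWord j v ∈ t then 0 else nodeTerm j v m

open Classical in
/-- The increment of `outerSum` if node `m + 1` is attached to `p`. -/
noncomputable def outerIncr (t : Set Node) (p m : ℕ) (j : TreeCode) : ℝ :=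
  ∑ v ∈ Finset.range (m + 1), if nodeWord j v ∈ t then 0 else nodeIncr j v p m

variable (t : Set Node)

theorem outerSum_congr {m : ℕ} (h : ∀ l < m, j l = j' l) : outerSum t m j = outerSum t m j' := by
  refine Finset.sum_congr rfl fun v hv => ?_
  rw [nodeTerm_congr v h, nodeWord_congr fun l hl => h l
    (hl.trans_le (Nat.lt_succ_iff.mp (Finset.mem_range.mp hv)))]

theorem outerIncr_congr {p m : ℕ} (hp : p ≤ m) (h : ∀ l < m, j l = j' l) :
    outerIncr t p m j = outerIncr t p m j' := by
  refine Finset.sum_congr rfl fun v hv => ?_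
  rw [nodeIncr_congr v hp h, nodeWord_congr fun l hl => h l
    (hl.trans_le (Nat.lt_succ_iff.mp (Finset.mem_range.mp hv)))]

theorem outerSum_succ (m : ℕ) :
    outerSum t (m + 1) j = outerSum t m j + outerIncr t (j m) m j := by
  rw [outerSum, Finset.sum_range_succ, nodeTerm_self, outerSum, outerIncr,
    ← Finset.sum_add_distrib]
  simp only [ite_self, add_zero]
  refine Finset.sum_congr rfl fun v hv => ?_
  split_ifs
  · simp
  · exact nodeTerm_succ (Nat.lt_succ_iff.mp (Finset.mem_range.mp hv))

theorem sum_outerIncr (m : ℕ) :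
    ∑ p ∈ Finset.range (m + 1), outerIncr t p m j = outerSum t m j := by
  simp only [outerIncr, outerSum]
  rw [Finset.sum_comm]
  refine Finset.sum_congr rfl fun v _ => ?_
  split_ifs
  · simp
  · exact sum_nodeIncr v m

/-- Only the `depth j p + 1` ancestors of `p` contribute. The bound does not involve `t`, which
makes the later moment estimates uniform in `t`. -/
theorem abs_outerIncr_le {p m : ℕ} (hp : p ≤ m) :
    |outerIncr t p m j| ≤ (depth j p + 1) * (1 + harm (m + 1)) := by
  have h := sum_anc (j := j) hp
  have h' : (depth j p + 1 : ℝ) = ∑ v ∈ Finset.range (m + 1), (anc j v p : ℝ) := by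
    exact_mod_cast h.symm
  rw [h', Finset.sum_mul]
  refine (Finset.abs_sum_le_sum_abs _ _).trans (Finset.sum_le_sum fun v _ => ?_)
  have := harm_nonneg (m + 1)
  split_ifs
  · simp; positivity
  · exact abs_nodeIncr_le v hp

theorem outerSum_update (m : ℕ) (p : Fin (m + 1)) :
    outerSum t (m + 1) (Function.update j m p) = outerSum t m j + outerIncr t p m j := by
  rw [outerSum_succ, Function.update_self,
    outerSum_congr t fun l hl => update_apply_of_lt hl p,
    outerIncr_congr t (Nat.lt_succ_iff.mp p.isLt) fun l hl => update_apply_of_lt hl p]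

theorem outerSum_eq_zero {k m : ℕ} (h : m ≤ k) : outerSum {u | l1norm u ≤ k} m j = 0 := by
  refine Finset.sum_eq_zero fun v hv => if_pos ?_
  have := Finset.mem_range.mp hv
  have := l1norm_nodeWord_le j v
  simp only [Set.mem_ofPred_eq]
  omega

/-- Each node except the root occurs once as a node and once as a child, so the terms `S H(S)`
telescope to that of the root, while the subtree sizes add up to the sum of `depth + 1`. -/
theorem outerSum_empty (m : ℕ) : outerSum ∅ m j =
    ∑ k ∈ Finset.range (m + 1), (depth j k : ℝ) - (m + 1) * harm (m + 1) + (m + 1) := by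
  have h1 : ∑ v ∈ Finset.range (m + 1), (subtreeSize j v m : ℝ) =
      ∑ k ∈ Finset.range (m + 1), ((depth j k : ℝ) + 1) := by
    have : ∑ v ∈ Finset.range (m + 1), subtreeSize j v m =
        ∑ k ∈ Finset.range (m + 1), (depth j k + 1) := by
      simp only [subtreeSize]
      rw [Finset.sum_comm]
      exact Finset.sum_congr rfl fun k hk => sum_anc (Nat.lt_succ_iff.mp (Finset.mem_range.mp hk))
    exact_mod_cast this
  have h2 : ∑ v ∈ Finset.range (m + 1), ∑ l ∈ Finset.range m, (if (j l : ℕ) = v then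
      (subtreeSize j (l + 1) m : ℝ) * harm (subtreeSize j (l + 1) m) else 0) =
      ∑ l ∈ Finset.range m,
        (subtreeSize j (l + 1) m : ℝ) * harm (subtreeSize j (l + 1) m) := by
    rw [Finset.sum_comm]
    refine Finset.sum_congr rfl fun l hl => ?_
    have := (j l).isLt
    have := Finset.mem_range.mp hl
    rw [Finset.sum_ite_eq, if_pos (Finset.mem_range.mpr (by omega))]
  simp only [outerSum, Set.mem_empty_iff_false, if_false, nodeTerm]
  rw [Finset.sum_add_distrib, Finset.sum_sub_distrib, h1, h2,
    Finset.sum_range_succ' (fun v => (subtreeSize j v m : ℝ) * harm (subtreeSize j v m)),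
    subtreeSize_root, Finset.sum_add_distrib]
  simp
  ring

/-- The mean increment is `outerSum / (m + 1)`, so the conditional mean grows by the factor `(m + 2)
/ (m + 1)`, which the normalization removes. -/
theorem stepAvg_outerSum_div (m : ℕ) :
    stepAvg m (fun j => outerSum t (m + 1) j / ((m : ℝ) + 2)) j =
      outerSum t m j / ((m : ℝ) + 1) := by
  rw [stepAvg_eq (fun p => (outerSum t m j + outerIncr t p m j) / ((m : ℝ) + 2))
    fun i => by rw [outerSum_update], ← Finset.sum_div, Finset.sum_add_distrib, sum_outerIncr]
  simp
  field_simp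
  ring

/-! ### From one-step averages to expectations and almost sure convergence -/

/-- `G` depends on the first `m` attachment choices only. -/
def DependsOnPast {β : Type*} (m : ℕ) (G : TreeCode → β) : Prop :=
  ∀ j j' : TreeCode, (∀ l < m, j l = j' l) → G j = G j'

/-- The tree code that starts with `x` and continues with zeros. -/
def extendPast (m : ℕ) (x : ∀ l : Finset.range m, Fin ((l : ℕ) + 1)) : TreeCode :=
  fun k => if h : k ∈ Finset.range m then x ⟨k, h⟩ else 0

/-- Such a function factors through a finite type; measurability, boundedness and integrability
follow at once. -/
theorem DependsOnPast.eq_extendPast {β : Type*} {m : ℕ} {G : TreeCode → β} (hG : DependsOnPast m G)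
    (j : TreeCode) : G j = G (extendPast m fun l => j l) := by
  refine hG _ _ fun l hl => ?_
  simp [extendPast, hl]

theorem DependsOnPast.stepAvg {m : ℕ} {G : TreeCode → ℝ} (hG : DependsOnPast (m + 1) G) :
    DependsOnPast m (stepAvg m G) := by
  intro j j' h
  unfold RecursiveTree.stepAvg
  congr 1
  refine Finset.sum_congr rfl fun i _ => hG _ _ fun l hl => ?_
  rcases (Nat.lt_succ_iff.mp hl).lt_or_eq with h1 | rfl
  · rw [update_apply_of_lt h1, update_apply_of_lt h1, h l h1]
  · simp

theorem DependsOnPast.mono {β : Type*} {m m' : ℕ} {G : TreeCode → β} (hG : DependsOnPast m G)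
    (h : m ≤ m') : DependsOnPast m' G :=
  fun j j' hj => hG j j' fun l hl => hj l (hl.trans_le h)

theorem DependsOnPast.exists_bound {m : ℕ} {G : TreeCode → ℝ} (hG : DependsOnPast m G) :
    ∃ C, ∀ j, |G j| ≤ C := by
  obtain ⟨C, hC⟩ := (Set.finite_range fun x => |G (extendPast m x)|).bddAbove
  exact ⟨C, fun j => by rw [hG.eq_extendPast j]; exact hC ⟨_, rfl⟩⟩

section

variable {Ω : Type*} [MeasurableSpace Ω] {P : Measure Ω} [IsProbabilityMeasure P]
  {J : ∀ k : ℕ, Ω → Fin (k + 1)}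

/-- The tree code formed by the random attachment choices. -/
def code (J : ∀ k : ℕ, Ω → Fin (k + 1)) (ω : Ω) : TreeCode := fun k => J k ω

/-- The first `m` attachment choices. -/
def history (J : ∀ k : ℕ, Ω → Fin (k + 1)) (m : ℕ) (ω : Ω) :
    ∀ l : Finset.range m, Fin ((l : ℕ) + 1) := fun l => J l ω

theorem measurable_history (hJ : IsRandomRecursive P J) (m : ℕ) : Measurable (history J m) :=
  measurable_pi_lambda _ fun l => hJ.measurable l

theorem DependsOnPast.comp_code {β : Type*} {m : ℕ} {G : TreeCode → β}
    (hG : DependsOnPast m G) (ω : Ω) :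
    G (code J ω) = (G ∘ extendPast m) (history J m ω) := hG.eq_extendPast _

theorem DependsOnPast.measurable {β : Type*} [MeasurableSpace β] {m : ℕ} {G : TreeCode → β}
    (hJ : IsRandomRecursive P J) (hG : DependsOnPast m G) :
    Measurable fun ω => G (code J ω) := by
  simp_rw [hG.comp_code]
  exact (measurable_of_finite (G ∘ extendPast m)).comp (measurable_history hJ m)

theorem DependsOnPast.integrable {m : ℕ} {G : TreeCode → ℝ}
    (hJ : IsRandomRecursive P J) (hG : DependsOnPast m G) :
    Integrable (fun ω => G (code J ω)) P := by
  obtain ⟨C, hC⟩ := hG.exists_bound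
  exact Integrable.of_bound (hG.measurable hJ).aestronglyMeasurable C (ae_of_all _ fun ω => hC _)

theorem DependsOnPast.memLp {m : ℕ} {G : TreeCode → ℝ}
    (hJ : IsRandomRecursive P J) (hG : DependsOnPast m G) (p : ℝ≥0∞) :
    MemLp (fun ω => G (code J ω)) p P := by
  obtain ⟨C, hC⟩ := hG.exists_bound
  exact MemLp.of_bound (hG.measurable hJ).aestronglyMeasurable C (ae_of_all _ fun ω => hC _)

/-- Averaging over the choice `m` does not change the mean. -/
theorem integral_stepAvg (hJ : IsRandomRecursive P J) {m : ℕ} {G : TreeCode → ℝ}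
    (hG : DependsOnPast (m + 1) G) :
    ∫ ω, G (code J ω) ∂P = ∫ ω, stepAvg m G (code J ω) ∂P := by
  have hdep : ∀ i : Fin (m + 1), DependsOnPast m fun j => G (Function.update j m i) := by
    intro i j j' h
    refine hG _ _ fun l hl => ?_
    rcases (Nat.lt_succ_iff.mp hl).lt_or_eq with h1 | rfl
    · rw [update_apply_of_lt h1, update_apply_of_lt h1, h l h1]
    · simp
  have hmeas : ∀ i : Fin (m + 1), MeasurableSet (J m ⁻¹' {i}) := fun i =>
    hJ.measurable m (measurableSet_singleton i)
  have hprod : ∀ i : Fin (m + 1),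
      ∫ ω, (J m ⁻¹' {i}).indicator 1 ω * G (Function.update (code J ω) m i) ∂P =
      (1 / ((m : ℝ) + 1)) * ∫ ω, G (Function.update (code J ω) m i) ∂P := by
    intro i
    -- Choice `m` is independent of the choices before it, and after `Function.update` the integrand
    -- depends on these only.
    have hind : IndepFun (J m) (history J m) P :=
      (hJ.indep.indepFun_finset {m} (Finset.range m) (by simp) hJ.measurable).comp
        (φ := fun x : ∀ l : ({m} : Finset ℕ), Fin ((l : ℕ) + 1) => x ⟨m, Finset.mem_singleton_self m⟩)
        (ψ := id) (measurable_of_finite _) measurable_id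
    have hind2 : IndepFun (fun ω => ({i} : Set (Fin (m + 1))).indicator (1 : Fin (m + 1) → ℝ) (J m ω))
        (fun ω => G (Function.update (code J ω) m i)) P := by
      simp_rw [fun ω => (hdep i).comp_code (J := J) ω]
      exact hind.comp
        (measurable_of_finite (({i} : Set (Fin (m + 1))).indicator (1 : Fin (m + 1) → ℝ)))
        (measurable_of_finite ((fun j => G (Function.update j m i)) ∘ extendPast m))
    have h1 := hind2.integral_mul_eq_mul_integral
      ((measurable_of_finite (({i} : Set (Fin (m + 1))).indicator (1 : Fin (m + 1) → ℝ))).comp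
        (hJ.measurable m)).aestronglyMeasurable
      ((hdep i).measurable hJ).aestronglyMeasurable
    have h2 : ∫ ω, ({i} : Set (Fin (m + 1))).indicator (1 : Fin (m + 1) → ℝ) (J m ω) ∂P =
        1 / ((m : ℝ) + 1) := by
      have : (fun ω => ({i} : Set (Fin (m + 1))).indicator (1 : Fin (m + 1) → ℝ) (J m ω)) =
          (J m ⁻¹' {i}).indicator 1 := by
        ext ω; simp [Set.indicator]
      rw [this, integral_indicator_one (hmeas i), Measure.real, hJ.uniform, ENNReal.toReal_inv, ENNReal.toReal_natCast]
      push_cast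
      rw [one_div]
    rw [h2] at h1
    exact h1
  -- Split according to the value of `J m`; on the event `J m = i` the update changes nothing.
  have hsum : ∀ ω, G (code J ω) = ∑ i : Fin (m + 1),
      (J m ⁻¹' {i}).indicator 1 ω * G (Function.update (code J ω) m i) := by
    intro ω
    rw [Finset.sum_eq_single (J m ω)]
    · simp only [Set.mem_preimage, Set.mem_singleton_iff, Set.indicator_of_mem, Pi.one_apply,
        one_mul]
      rw [show J m ω = code J ω m from rfl, Function.update_eq_self]
    · intro i _ hi
      rw [Set.indicator_of_notMem (by simpa using hi.symm), zero_mul]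
    · simp
  simp_rw [hsum]
  rw [integral_finsetSum]
  · simp_rw [hprod]
    simp only [stepAvg, Finset.sum_div]
    rw [integral_finsetSum]
    · refine Finset.sum_congr rfl fun i _ => ?_
      rw [integral_div]
      ring
    · intro i _
      exact ((hdep i).integrable hJ).div_const _
  · intro i _
    have : (fun ω => (J m ⁻¹' {i}).indicator 1 ω * G (Function.update (code J ω) m i)) =
        (J m ⁻¹' {i}).indicator fun ω => G (Function.update (code J ω) m i) := by
      ext ω
      by_cases h : ω ∈ J m ⁻¹' {i} <;> simp [h]
    rw [this]
    exact ((hdep i).integrable hJ).indicator (hmeas i)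

/-- The filtration generated by the attachment choices, started at time `m`. -/
def pastFiltration (hJ : IsRandomRecursive P J) (m : ℕ) : Filtration ℕ ‹MeasurableSpace Ω› where
  seq k := MeasurableSpace.comap (history J (m + k)) inferInstance
  mono' k k' h := by
    have hm : Measurable[MeasurableSpace.comap (history J (m + k')) inferInstance]
        (history J (m + k)) := by
      let r : (∀ l : Finset.range (m + k'), Fin ((l : ℕ) + 1)) →
          ∀ l : Finset.range (m + k), Fin ((l : ℕ) + 1) := fun x l =>
        x ⟨l, Finset.range_subset_range.mpr (by omega) l.2⟩
      exact (measurable_of_finite r).comp (comap_measurable (history J (m + k')))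
    exact hm.comap_le
  le' k := (measurable_history hJ _).comap_le

/-- A submartingale that is bounded in `L¹` converges almost surely. -/
theorem ae_tendsto_of_le_stepAvg (hJ : IsRandomRecursive P J) {m₀ : ℕ} {g : ℕ → TreeCode → ℝ}
    (hg : ∀ m, DependsOnPast m (g m))
    (hs : ∀ m ≥ m₀, ∀ j, g m j ≤ stepAvg m (g (m + 1)) j) {C : ℝ}
    (hC : ∀ m ≥ m₀, ∫ ω, |g m (code J ω)| ∂P ≤ C) :
    ∀ᵐ ω ∂P, ∃ c, Tendsto (fun m => g m (code J ω)) atTop (𝓝 c) := by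
  have hsub : Submartingale (fun k ω => g (m₀ + k) (code J ω)) (pastFiltration hJ m₀) P := by
    refine submartingale_of_setIntegral_le_succ ?_ (fun k => (hg _).integrable hJ) ?_
    · intro k
      have : (fun ω => g (m₀ + k) (code J ω)) =
          (g (m₀ + k) ∘ extendPast (m₀ + k)) ∘ history J (m₀ + k) := by
        ext ω; exact (hg _).comp_code ω
      change StronglyMeasurable[MeasurableSpace.comap (history J (m₀ + k)) inferInstance]
        (fun ω => g (m₀ + k) (code J ω))
      rw [this]
      exact ((measurable_of_finite _).comp
        (comap_measurable (history J (m₀ + k)))).stronglyMeasurable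
    · rintro k s ⟨S, -, rfl⟩
      have hms : MeasurableSet (history J (m₀ + k) ⁻¹' S) :=
        measurable_history hJ _ S.toFinite.measurableSet
      -- An event of the past has an indicator that depends on the past only, so it can be pulled
      -- out of `stepAvg`.
      set χ : TreeCode → ℝ := fun j => S.indicator 1 (fun l : Finset.range (m₀ + k) => j l) with hχ
      have hχd : DependsOnPast (m₀ + k) χ := by
        intro j j' h
        simp only [hχ]
        congr 1
        funext l
        exact h l (Finset.mem_range.mp l.2)
      have hind : ∀ f : Ω → ℝ, ∫ ω in history J (m₀ + k) ⁻¹' S, f ω ∂P =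
          ∫ ω, χ (code J ω) * f ω ∂P := by
        intro f
        rw [← integral_indicator hms]
        congr 1
        ext ω
        by_cases h : history J (m₀ + k) ω ∈ S
        · rw [Set.indicator_of_mem (by exact h)]
          have : χ (code J ω) = 1 := Set.indicator_of_mem h _
          rw [this, one_mul]
        · rw [Set.indicator_of_notMem (by exact h)]
          have : χ (code J ω) = 0 := Set.indicator_of_notMem h _
          rw [this, zero_mul]
      have hχ0 : ∀ j, 0 ≤ χ j := fun j => Set.indicator_nonneg (by simp) _
      have hd1 : DependsOnPast (m₀ + k + 1) fun j => χ j * g (m₀ + (k + 1)) j := by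
        intro j j' h
        simp only
        rw [hχd j j' fun l hl => h l (by omega), hg _ j j' fun l hl => h l (by omega)]
      rw [hind, hind, integral_stepAvg hJ hd1]
      refine integral_mono ?_ (hd1.stepAvg.integrable hJ) fun ω => ?_
      · have : DependsOnPast (m₀ + k) fun j => χ j * g (m₀ + k) j := by
          intro j j' h
          simp only
          rw [hχd j j' h, hg _ j j' h]
        exact this.integrable hJ
      · have : stepAvg (m₀ + k) (fun j => χ j * g (m₀ + (k + 1)) j) (code J ω) =
            χ (code J ω) * stepAvg (m₀ + k) (g (m₀ + k + 1)) (code J ω) := by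
          rw [← stepAvg_const_mul]
          simp only [stepAvg]
          congr 1
          refine Finset.sum_congr rfl fun i _ => ?_
          rw [hχd _ (code J ω) fun l hl => update_apply_of_lt hl i]
          rfl
        rw [this]
        exact mul_le_mul_of_nonneg_left (hs _ (by omega) _) (hχ0 _)
  have hb : ∀ k, eLpNorm (fun ω => g (m₀ + k) (code J ω)) 1 P ≤ (C.toNNReal : ℝ≥0∞) := by
    intro k
    rw [eLpNorm_one_eq_lintegral_enorm, ← ofReal_integral_norm_eq_lintegral_enorm
      ((hg _).integrable hJ)]
    exact ENNReal.ofReal_le_ofReal (hC _ (by omega))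
  filter_upwards [hsub.exists_ae_tendsto_of_bdd hb] with ω ⟨c, hc⟩
  refine ⟨c, ?_⟩
  rw [← tendsto_add_atTop_iff_nat m₀]
  simpa only [add_comm] using hc

/-- Almost surely every node has infinitely many children. -/
theorem ae_infinite_children (hJ : IsRandomRecursive P J) :
    ∀ᵐ ω ∂P, ∀ p : ℕ, {k : ℕ | (J k ω : ℕ) = p}.Infinite := by
  rw [ae_all_iff]
  intro p
  set s : ℕ → Set Ω := fun k => J k ⁻¹' {i | (i : ℕ) = p} with hs
  have hsm : ∀ k, MeasurableSet (s k) := fun k => hJ.measurable k (Set.toFinite _).measurableSet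
  have hind : iIndepSet s P := by
    rw [iIndepSet_iff_meas_biInter hsm]
    intro S
    exact hJ.indep.measure_inter_preimage_eq_mul S
      (sets := fun k => {i : Fin (k + 1) | (i : ℕ) = p})
      fun k _ => (Set.toFinite _).measurableSet
  -- Second Borel–Cantelli lemma: node `k + 1` chooses `p` with probability `1 / (k + 1)`, a
  -- divergent series. The shift by `p` ensures that `p` is already present.
  have hsum : ∑' k, P (s k) = ∞ := by
    have h1 : ∀ k, P (s (k + p)) = ENNReal.ofReal (1 / ((k + p + 1 : ℕ) : ℝ)) := by
      intro k
      have : s (k + p) = J (k + p) ⁻¹' {⟨p, by omega⟩} := by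
        ext ω
        simp [hs, Fin.ext_iff]
      rw [this, hJ.uniform, ENNReal.ofReal_div_of_pos (by positivity), ENNReal.ofReal_natCast]
      simp
    by_contra hne
    have h2 : ∑' k, P (s (k + p)) ≠ ∞ := by
      refine ne_top_of_le_ne_top hne ?_
      exact ENNReal.tsum_comp_le_tsum_of_injective (add_left_injective p) _
    simp_rw [h1] at h2
    have h3 : Summable fun k : ℕ => 1 / ((k + p + 1 : ℕ) : ℝ) := by
      have := ENNReal.summable_toReal h2
      refine this.congr fun k => ENNReal.toReal_ofReal (by positivity)
    have h4 : Summable fun k : ℕ => 1 / (k : ℝ) :=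
      (summable_nat_add_iff (f := fun k : ℕ => 1 / (k : ℝ)) (p + 1)).mp h3
    exact Real.not_summable_one_div_natCast h4
  have h := measure_limsup_eq_one hsm hind hsum
  have h' : ∀ᵐ ω ∂P, ω ∈ limsup s atTop := by
    rw [← prob_compl_eq_zero_iff (MeasurableSet.measurableSet_limsup hsm)] at h
    exact h
  filter_upwards [h'] with ω hω
  rw [mem_limsup_iff_frequently_mem] at hω
  exact Nat.frequently_atTop_iff_infinite.mp hω

end

/-! ### Uniform bounds for even moments -/

/-- Binomial expansion: every term with at least two factors `y` is dominated by one of the extreme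
ones, and the coefficients sum to at most `2 ^ (2r + 2)`. The linear term is kept exact because it
averages to zero for a martingale. -/
theorem add_pow_even_le (r : ℕ) (x y : ℝ) :
    (x + y) ^ (2 * r + 2) ≤ x ^ (2 * r + 2) + (2 * r + 2) * x ^ (2 * r + 1) * y +
      4 ^ (r + 1) * (x ^ (2 * r) * y ^ 2 + y ^ (2 * r + 2)) := by
  set A := x ^ (2 * r) * y ^ 2 + y ^ (2 * r + 2) with hA
  have hev : Even (2 * r) := even_two_mul r
  have hev2 : Even (2 * r + 2) := hev.add even_two
  have hA' : A = |x| ^ (2 * r) * |y| ^ 2 + |y| ^ (2 * r + 2) := by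
    rw [hA, hev.pow_abs, hev2.pow_abs, sq_abs]
  have hA0 : 0 ≤ A := by rw [hA']; positivity
  have hterm : ∀ k ∈ Finset.range (2 * r + 1),
      x ^ k * y ^ (2 * r + 2 - k) * ((2 * r + 2).choose k : ℝ) ≤
        A * ((2 * r + 2).choose k : ℝ) := by
    intro k hk
    have hk : k ≤ 2 * r := Nat.lt_succ_iff.mp (Finset.mem_range.mp hk)
    refine mul_le_mul_of_nonneg_right ?_ (Nat.cast_nonneg _)
    refine (le_abs_self _).trans ?_
    rw [abs_mul, abs_pow, abs_pow, hA']
    have hx := abs_nonneg x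
    have hy := abs_nonneg y
    rcases le_total |y| |x| with h | h
    · have h1 : |y| ^ (2 * r + 2 - k) = |y| ^ (2 * r - k) * |y| ^ 2 := by
        rw [← pow_add]; congr 1; omega
      have h2 : |x| ^ (2 * r) = |x| ^ k * |x| ^ (2 * r - k) := by
        rw [← pow_add]; congr 1; omega
      have h3 : |x| ^ k * |y| ^ (2 * r + 2 - k) ≤ |x| ^ (2 * r) * |y| ^ 2 := by
        rw [h1, h2, ← mul_assoc]
        gcongr
      have : 0 ≤ |y| ^ (2 * r + 2) := by positivity
      linarith
    · have h1 : |y| ^ (2 * r + 2) = |y| ^ k * |y| ^ (2 * r + 2 - k) := by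
        rw [← pow_add]; congr 1; omega
      have h3 : |x| ^ k * |y| ^ (2 * r + 2 - k) ≤ |y| ^ (2 * r + 2) := by
        rw [h1]
        gcongr
      have : 0 ≤ |x| ^ (2 * r) * |y| ^ 2 := by positivity
      linarith
  have hsum : ∑ k ∈ Finset.range (2 * r + 1), ((2 * r + 2).choose k : ℝ) ≤ 4 ^ (r + 1) := by
    have h1 : ∑ k ∈ Finset.range (2 * r + 1), (2 * r + 2).choose k ≤ 2 ^ (2 * r + 2) := by
      rw [← Nat.sum_range_choose]
      exact Finset.sum_le_sum_of_subset (Finset.range_subset_range.mpr (by omega))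
    have h2 : (2 : ℕ) ^ (2 * r + 2) = 4 ^ (r + 1) := by
      rw [show 2 * r + 2 = 2 * (r + 1) by ring, pow_mul]; norm_num
    rw [h2] at h1
    exact_mod_cast h1
  have h4 : ∑ k ∈ Finset.range (2 * r + 1),
      x ^ k * y ^ (2 * r + 2 - k) * ((2 * r + 2).choose k : ℝ) ≤ 4 ^ (r + 1) * A := by
    refine (Finset.sum_le_sum hterm).trans ?_
    rw [← Finset.mul_sum, mul_comm]
    exact mul_le_mul_of_nonneg_right hsum hA0
  rw [add_pow, Finset.sum_range_succ, Finset.sum_range_succ,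
    show 2 * r + 2 - (2 * r + 1) = 1 by omega, Nat.sub_self, Nat.choose_self,
    show (2 * r + 2).choose (2 * r + 1) = 2 * r + 2 from Nat.choose_succ_self_right (2 * r + 1)]
  push_cast
  nlinarith [h4]

/-- A weighted Young inequality, by comparing `Y` with `w X`. The free weight `w` will be chosen
summable in time. -/
theorem pow_mul_le_young (r : ℕ) {X Y w : ℝ} (hX : 0 ≤ X) (hY : 0 ≤ Y) (hw : 0 < w) :
    X ^ r * Y ≤ w * X ^ (r + 1) + w⁻¹ ^ r * Y ^ (r + 1) := by
  rcases le_total Y (w * X) with h | h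
  · have h1 : X ^ r * Y ≤ X ^ r * (w * X) := by gcongr
    have h2 : 0 ≤ w⁻¹ ^ r * Y ^ (r + 1) := by positivity
    calc X ^ r * Y ≤ X ^ r * (w * X) := h1
      _ = w * X ^ (r + 1) := by ring
      _ ≤ _ := by linarith
  · have h0 : X ≤ w⁻¹ * Y := by
      rw [inv_mul_eq_div, le_div_iff₀ hw]; linarith
    have h1 : X ^ r * Y ≤ (w⁻¹ * Y) ^ r * Y := by gcongr
    have h2 : 0 ≤ w * X ^ (r + 1) := by positivity
    calc X ^ r * Y ≤ (w⁻¹ * Y) ^ r * Y := h1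
      _ = w⁻¹ ^ r * Y ^ (r + 1) := by rw [mul_pow]; ring
      _ ≤ _ := by linarith

theorem add_pow_even_le_young (r : ℕ) (x y : ℝ) {w : ℝ} (hw : 0 < w) (hw1 : w ≤ 1) :
    (x + y) ^ (2 * r + 2) ≤ x ^ (2 * r + 2) + (2 * r + 2) * x ^ (2 * r + 1) * y +
      4 ^ (r + 1) * (w * x ^ (2 * r + 2) + 2 * w⁻¹ ^ r * y ^ (2 * r + 2)) := by
  refine (add_pow_even_le r x y).trans ?_
  have h1 := pow_mul_le_young r (sq_nonneg x) (sq_nonneg y) hw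
  simp only [← pow_mul] at h1
  rw [show 2 * (r + 1) = 2 * r + 2 by ring] at h1
  have h2 : (1 : ℝ) ≤ w⁻¹ ^ r := one_le_pow₀ ((one_le_inv₀ hw).mpr hw1)
  have h3 : 0 ≤ y ^ (2 * r + 2) := ((even_two_mul r).add even_two).pow_nonneg y
  have h4 : y ^ (2 * r + 2) ≤ w⁻¹ ^ r * y ^ (2 * r + 2) := le_mul_of_one_le_left h3 h2
  have h5 : x ^ (2 * r) * y ^ 2 + y ^ (2 * r + 2) ≤
      w * x ^ (2 * r + 2) + 2 * w⁻¹ ^ r * y ^ (2 * r + 2) := by linarith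
  have h6 := mul_le_mul_of_nonneg_left h5 (show (0 : ℝ) ≤ 4 ^ (r + 1) by positivity)
  linarith

/-- The mean of `(5/4) ^ depth` over the nodes `0, …, m`. -/
noncomputable def depthMean (m : ℕ) (j : TreeCode) : ℝ :=
  (∑ p ∈ Finset.range (m + 1), (5 / 4 : ℝ) ^ depth j p) / ((m : ℝ) + 1)

theorem depthMean_nonneg (m : ℕ) (j : TreeCode) : 0 ≤ depthMean m j :=
  div_nonneg (Finset.sum_nonneg fun _ _ => by positivity) (by positivity)

theorem depthMean_dependsOnPast (m : ℕ) : DependsOnPast m (depthMean m) := by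
  intro j j' h
  unfold depthMean
  congr 1
  refine Finset.sum_congr rfl fun p hp => ?_
  rw [depth_congr fun l hl => h l (hl.trans_le (Nat.lt_succ_iff.mp (Finset.mem_range.mp hp)))]

/-- A child of `p` contributes `5/4` times the value of `p`. The base `5/4` makes the mean grow no
faster than `(m + 1) ^ (1/4)`, half of the power `(m + 1) ^ (1/2)` that the moment bound has to
spare. -/
theorem stepAvg_depthMean (m : ℕ) (j : TreeCode) :
    stepAvg m (depthMean (m + 1)) j = (1 + 1 / (4 * ((m : ℝ) + 2))) * depthMean m j := by
  rw [stepAvg_eq (fun p => (∑ p ∈ Finset.range (m + 1), (5 / 4 : ℝ) ^ depth j p +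
    (5 / 4) * (5 / 4) ^ depth j p) / ((m : ℝ) + 2))]
  · rw [← Finset.sum_div, Finset.sum_add_distrib, ← Finset.mul_sum, depthMean]
    simp
    field_simp
    ring
  · intro i
    rw [depthMean, Finset.sum_range_succ, depth_succ, Function.update_self]
    have hc : ∀ p ≤ m, depth (Function.update j m i) p = depth j p := fun p hp =>
      depth_congr fun l hl => update_apply_of_lt (hl.trans_le hp) i
    rw [hc i (Nat.lt_succ_iff.mp i.isLt), Finset.sum_congr rfl fun p hp => by
      rw [hc p (Nat.lt_succ_iff.mp (Finset.mem_range.mp hp))]]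
    push_cast
    congr 1
    · ring
    · ring

section

variable {Ω : Type*} [MeasurableSpace Ω] {P : Measure Ω} [IsProbabilityMeasure P]
  {J : ∀ k : ℕ, Ω → Fin (k + 1)}

theorem integral_depthMean_le (hJ : IsRandomRecursive P J) (m : ℕ) :
    ∫ ω, depthMean m (code J ω) ∂P ≤ ((m : ℝ) + 1) ^ (1 / 4 : ℝ) := by
  induction m with
  | zero => simp [depthMean, depth_zero]
  | succ m ih =>
    rw [integral_stepAvg hJ (depthMean_dependsOnPast (m + 1))]
    simp_rw [stepAvg_depthMean]
    rw [integral_const_mul]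
    set y : ℝ := 1 / (4 * ((m : ℝ) + 2)) with hy
    have hm : (0 : ℝ) < (m : ℝ) + 2 := by positivity
    have hy0 : 0 ≤ y := by positivity
    have h1 : ((m : ℝ) + 1) = (1 + -(1 / ((m : ℝ) + 2))) * ((m : ℝ) + 2) := by
      field_simp; ring
    have h2 : (1 : ℝ) / ((m : ℝ) + 2) ≤ 1 := by
      rw [div_le_one hm]; have := Nat.cast_nonneg (α := ℝ) m; linarith
    -- Bernoulli's inequality for the concave power `1/4`; it suffices since `(1 + y) * (1 - y) ≤
    -- 1`.
    have h3 : (1 + -(1 / ((m : ℝ) + 2))) ^ (1 / 4 : ℝ) ≤ 1 - y := by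
      refine (rpow_one_add_le_one_add_mul_self (by linarith) (by norm_num)
        (by norm_num)).trans_eq ?_
      rw [hy]; field_simp; ring
    have h4 : ((m : ℝ) + 1) ^ (1 / 4 : ℝ) ≤ (1 - y) * ((m : ℝ) + 2) ^ (1 / 4 : ℝ) := by
      rw [h1, Real.mul_rpow (by linarith) hm.le]
      gcongr
    have h5 : 0 ≤ ((m : ℝ) + 2) ^ (1 / 4 : ℝ) := by positivity
    have h6 : (((m + 1 : ℕ) : ℝ) + 1) = (m : ℝ) + 2 := by push_cast; ring
    rw [h6]
    calc (1 + y) * ∫ ω, depthMean m (code J ω) ∂P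
        ≤ (1 + y) * ((1 - y) * ((m : ℝ) + 2) ^ (1 / 4 : ℝ)) := by
          gcongr; exact ih.trans h4
      _ = (1 - y ^ 2) * ((m : ℝ) + 2) ^ (1 / 4 : ℝ) := by ring
      _ ≤ ((m : ℝ) + 2) ^ (1 / 4 : ℝ) := by nlinarith [sq_nonneg y]

end

theorem exists_pow_le_mul_pow (r : ℕ) : ∃ C : ℝ, 0 ≤ C ∧ ∀ D : ℕ,
    ((D : ℝ) + 1) ^ r ≤ C * (5 / 4) ^ D := by
  have h := tendsto_pow_const_div_const_pow_of_one_lt r (show (1 : ℝ) < 5 / 4 by norm_num)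
  obtain ⟨C, hC⟩ := h.bddAbove_range
  have hC' : ∀ n : ℕ, (n : ℝ) ^ r / (5 / 4) ^ n ≤ C := fun n => hC ⟨n, rfl⟩
  have hC0 : 0 ≤ C := le_trans (by positivity) (hC' 0)
  refine ⟨C * (5 / 4), by positivity, fun D => ?_⟩
  have := hC' (D + 1)
  rw [div_le_iff₀ (by positivity)] at this
  push_cast at this
  calc _ ≤ _ := this
    _ = _ := by ring

theorem exists_harm_pow_le (q : ℕ) : ∃ C : ℝ, 0 ≤ C ∧ ∀ m : ℕ,
    (1 + harm (m + 1)) ^ q ≤ C * ((m : ℝ) + 1) ^ (1 / 4 : ℝ) := by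
  -- Chosen such that `ε * q ≤ 1 / 4`.
  set ε : ℝ := 1 / (4 * (q + 1)) with hε
  have hε0 : 0 < ε := by positivity
  refine ⟨(2 + 1 / ε) ^ q, by positivity, fun m => ?_⟩
  have hm : (1 : ℝ) ≤ (m : ℝ) + 1 := by have := Nat.cast_nonneg (α := ℝ) m; linarith
  have h1 : harm (m + 1) ≤ 1 + Real.log ((m : ℝ) + 1) := by
    have := harmonic_le_one_add_log (m + 1)
    push_cast at this
    simpa [harm] using this
  have h2 := Real.log_le_rpow_div (show (0 : ℝ) ≤ (m : ℝ) + 1 by linarith) hε0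
  have h3 : (1 : ℝ) ≤ ((m : ℝ) + 1) ^ ε := Real.one_le_rpow hm hε0.le
  have h4 : 1 + harm (m + 1) ≤ (2 + 1 / ε) * ((m : ℝ) + 1) ^ ε := by
    have : ((m : ℝ) + 1) ^ ε / ε = 1 / ε * ((m : ℝ) + 1) ^ ε := by ring
    nlinarith
  calc (1 + harm (m + 1)) ^ q ≤ ((2 + 1 / ε) * ((m : ℝ) + 1) ^ ε) ^ q := by
        have := harm_nonneg (m + 1)
        gcongr
    _ = (2 + 1 / ε) ^ q * ((m : ℝ) + 1) ^ (ε * q) := by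
        rw [mul_pow, ← Real.rpow_natCast (((m : ℝ) + 1) ^ ε), ← Real.rpow_mul (by linarith)]
    _ ≤ (2 + 1 / ε) ^ q * ((m : ℝ) + 1) ^ (1 / 4 : ℝ) := by
        gcongr
        · rw [hε, div_mul_eq_mul_div, div_le_div_iff₀ (by positivity) (by norm_num)]
          nlinarith

/-- The weights `(m + 1) ^ (-3/2)`. -/
noncomputable def weight (m : ℕ) : ℝ := (√((m : ℝ) + 1))⁻¹ ^ 3

theorem one_le_sqrt_succ (m : ℕ) : 1 ≤ √((m : ℝ) + 1) := by
  rw [Real.one_le_sqrt]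
  have := Nat.cast_nonneg (α := ℝ) m
  linarith

theorem weight_pos (m : ℕ) : 0 < weight m := by unfold weight; positivity

theorem weight_le_one (m : ℕ) : weight m ≤ 1 :=
  pow_le_one₀ (by positivity) (inv_le_one_of_one_le₀ (one_le_sqrt_succ m))

theorem summable_weight : Summable weight := by
  have h : Summable fun n : ℕ => 1 / (n : ℝ) ^ (3 / 2 : ℝ) :=
    Real.summable_one_div_nat_rpow.mpr (by norm_num)
  refine ((summable_nat_add_iff 1).mpr h).congr fun m => ?_
  rw [weight, Real.sqrt_eq_rpow, inv_pow, ← Real.rpow_natCast, ← Real.rpow_mul (by positivity)]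
  norm_num

/-- The conditional moment bound for one step. -/
theorem stepAvg_outerSum_pow_le (r : ℕ) : ∃ C : ℝ, 0 ≤ C ∧ ∀ (t : Set Node) (m : ℕ) (j : TreeCode),
    stepAvg m (fun j => (outerSum t (m + 1) j / ((m : ℝ) + 2)) ^ (2 * r + 2)) j ≤
      (1 + C * weight m) * (outerSum t m j / ((m : ℝ) + 1)) ^ (2 * r + 2) +
        C * weight m * (((m : ℝ) + 1) ^ (1 / 4 : ℝ))⁻¹ * depthMean m j := by
  obtain ⟨C₁, hC₁, h₁⟩ := exists_pow_le_mul_pow (2 * r + 2)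
  obtain ⟨C₂, hC₂, h₂⟩ := exists_harm_pow_le (2 * r + 2)
  set K : ℝ := 4 ^ (r + 1) with hK
  have hK0 : 0 ≤ K := by positivity
  refine ⟨K + 2 * K * K + 2 * K * K * (C₁ * C₂), by positivity, fun t m j => ?_⟩
  set w := weight m with hw
  have hw0 : 0 < w := weight_pos m
  set n : ℝ := (m : ℝ) + 1 with hn
  have hn1 : (m : ℝ) + 2 = n + 1 := by rw [hn]; ring
  have hn0 : 0 < n := by positivity
  set s : ℝ := √n with hs
  have hs1 : 1 ≤ s := one_le_sqrt_succ m
  have hs0 : 0 < s := by linarith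
  have hsn : s ^ 2 = n := Real.sq_sqrt hn0.le
  set R := outerSum t m j / n with hR
  have hRn : outerSum t m j = n * R := by rw [hR]; field_simp
  have hev : Even (2 * r + 2) := (even_two_mul r).add even_two
  have hKK : (2 : ℝ) ^ (2 * r + 2) = K := by
    rw [hK, show 2 * r + 2 = 2 * (r + 1) by ring, pow_mul]; norm_num
  set δ : ℕ → ℝ := fun p => outerIncr t p m j with hδ
  have hδsum : ∑ p ∈ Finset.range (m + 1), δ p = n * R := by rw [hδ, sum_outerIncr, hRn]
  -- The coefficient of the remainder: `2 * K * w⁻¹ ^ r` from Young's inequality, the rest from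
  -- bounding the power of `(δ p - R) / (n + 1)`.
  set c : ℝ := 2 * K * w⁻¹ ^ r * (K * (n⁻¹) ^ (2 * r + 2)) with hc
  have hc0 : 0 ≤ c := by positivity
  have hpt : ∀ p, ((n * R + δ p) / (n + 1)) ^ (2 * r + 2) ≤ R ^ (2 * r + 2) +
      (2 * r + 2) * R ^ (2 * r + 1) * ((δ p - R) / (n + 1)) +
      (K * w * R ^ (2 * r + 2) + c * (δ p ^ (2 * r + 2) + R ^ (2 * r + 2))) := by
    intro p
    have e1 : (n * R + δ p) / (n + 1) = R + (δ p - R) / (n + 1) := by field_simp; ring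
    rw [e1]
    refine (add_pow_even_le_young r R _ hw0 (weight_le_one m)).trans ?_
    have e2 : ((δ p - R) / (n + 1)) ^ (2 * r + 2) ≤
        K * (n⁻¹) ^ (2 * r + 2) * (δ p ^ (2 * r + 2) + R ^ (2 * r + 2)) := by
      have e3 : (δ p - R) ^ (2 * r + 2) ≤ K * (δ p ^ (2 * r + 2) + R ^ (2 * r + 2)) := by
        have := hev.add_pow_le (a := δ p) (b := -R)
        rw [hev.neg_pow, ← sub_eq_add_neg] at this
        refine this.trans ?_
        have : (2 : ℝ) ^ (2 * r + 2 - 1) ≤ K := by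
          rw [← hKK]; exact pow_le_pow_right₀ (by norm_num) (by omega)
        have h0 : 0 ≤ δ p ^ (2 * r + 2) + R ^ (2 * r + 2) :=
          add_nonneg (hev.pow_nonneg _) (hev.pow_nonneg _)
        gcongr
      rw [div_pow, div_eq_mul_inv, ← inv_pow]
      have e4 : (n + 1)⁻¹ ^ (2 * r + 2) ≤ n⁻¹ ^ (2 * r + 2) := by
        gcongr; linarith
      calc (δ p - R) ^ (2 * r + 2) * (n + 1)⁻¹ ^ (2 * r + 2)
          ≤ (K * (δ p ^ (2 * r + 2) + R ^ (2 * r + 2))) * n⁻¹ ^ (2 * r + 2) :=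
            mul_le_mul e3 e4 (by positivity) ((hev.pow_nonneg _).trans e3)
        _ = _ := by ring
    have e5 : K * (2 * w⁻¹ ^ r * ((δ p - R) / (n + 1)) ^ (2 * r + 2)) ≤
        c * (δ p ^ (2 * r + 2) + R ^ (2 * r + 2)) := by
      calc _ ≤ K * (2 * w⁻¹ ^ r *
            (K * (n⁻¹) ^ (2 * r + 2) * (δ p ^ (2 * r + 2) + R ^ (2 * r + 2)))) := by gcongr
        _ = _ := by rw [hc]; ring
    linarith
  have hstep : stepAvg m (fun j => (outerSum t (m + 1) j / ((m : ℝ) + 2)) ^ (2 * r + 2)) j =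
      (∑ p ∈ Finset.range (m + 1), ((n * R + δ p) / (n + 1)) ^ (2 * r + 2)) / n :=
    stepAvg_eq _ fun i => by rw [outerSum_update, hRn, hn1]
  -- The martingale property: the linear term of the expansion averages to zero.
  have hlin : ∑ p ∈ Finset.range (m + 1), ((δ p - R) / (n + 1)) = 0 := by
    rw [← Finset.sum_div, Finset.sum_sub_distrib, hδsum]
    simp [hn]
  have hδpow : (∑ p ∈ Finset.range (m + 1), δ p ^ (2 * r + 2)) / n ≤
      C₁ * C₂ * n ^ (1 / 4 : ℝ) * depthMean m j := by
    have : ∀ p ∈ Finset.range (m + 1), δ p ^ (2 * r + 2) ≤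
        C₁ * C₂ * n ^ (1 / 4 : ℝ) * (5 / 4) ^ depth j p := by
      intro p hp
      have hp := Nat.lt_succ_iff.mp (Finset.mem_range.mp hp)
      have hh := harm_nonneg (m + 1)
      calc δ p ^ (2 * r + 2) = |δ p| ^ (2 * r + 2) := (hev.pow_abs _).symm
        _ ≤ ((depth j p + 1) * (1 + harm (m + 1))) ^ (2 * r + 2) := by
            gcongr; exact abs_outerIncr_le t hp
        _ = (depth j p + 1) ^ (2 * r + 2) * (1 + harm (m + 1)) ^ (2 * r + 2) := mul_pow _ _ _
        _ ≤ (C₁ * (5 / 4) ^ depth j p) * (C₂ * n ^ (1 / 4 : ℝ)) := by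
            gcongr
            · exact h₁ _
            · exact h₂ m
        _ = _ := by ring
    rw [depthMean, ← hn, mul_div_assoc', Finset.mul_sum]
    gcongr with p hp
    exact this p hp
  have hq : (n ^ (1 / 4 : ℝ)) * (n ^ (1 / 4 : ℝ)) = s := by
    rw [← Real.rpow_add hn0, hs, Real.sqrt_eq_rpow]; norm_num
  have hq0 : 0 < n ^ (1 / 4 : ℝ) := by positivity
  -- Powers of `s = √n`: `w⁻¹ ^ r` gives `s ^ (3r)` and `n⁻¹ ^ (2r + 2)` gives `s ^ (-4r - 4)`.
  -- Compared with `w = s ^ (-3)` at least one factor `s⁻¹` is left.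
  have hcs : c = 2 * K * K * (s⁻¹ ^ (r + 4)) := by
    have hwi : w⁻¹ = s ^ 3 := by rw [hw, weight, inv_pow, inv_inv]
    have e' : n⁻¹ ^ (2 * r + 2) = s⁻¹ ^ (3 * r + (r + 4)) := by
      rw [← hsn, ← inv_pow, ← pow_mul]
      congr 1
      ring
    have e'' : s ^ (3 * r) * s⁻¹ ^ (3 * r) = 1 := by
      rw [← mul_pow, mul_inv_cancel₀ hs0.ne', one_pow]
    rw [hc, hwi, e', pow_add, ← pow_mul]
    linear_combination (2 * K * K * s⁻¹ ^ (r + 4)) * e''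
  have hws : w = s⁻¹ ^ 3 := rfl
  have hsi : s⁻¹ ≤ 1 := inv_le_one_of_one_le₀ hs1
  have hc1 : c ≤ 2 * K * K * w := by
    rw [hcs, hws]
    have : s⁻¹ ^ (r + 4) ≤ s⁻¹ ^ 3 := pow_le_pow_of_le_one (by positivity) hsi (by omega)
    gcongr
  -- The spare factor `s⁻¹` is split into two factors `n ^ (-1/4)`: one absorbs the powers of
  -- harmonic numbers, the other is kept to absorb the mean of `depthMean`.
  have hc2 : c * n ^ (1 / 4 : ℝ) ≤ 2 * K * K * w * (n ^ (1 / 4 : ℝ))⁻¹ := by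
    rw [← div_eq_mul_inv, le_div_iff₀ hq0, mul_assoc, hq, hcs, hws]
    have : s⁻¹ ^ (r + 4) * s = s⁻¹ ^ (r + 3) := by
      rw [pow_succ _ (r + 3), mul_assoc, inv_mul_cancel₀ hs0.ne', mul_one]
    rw [mul_assoc, this]
    have : s⁻¹ ^ (r + 3) ≤ s⁻¹ ^ 3 := pow_le_pow_of_le_one (by positivity) hsi (by omega)
    gcongr
  have hD0 : 0 ≤ depthMean m j := depthMean_nonneg m j
  have hR0 : 0 ≤ R ^ (2 * r + 2) := hev.pow_nonneg _
  rw [hstep]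
  calc (∑ p ∈ Finset.range (m + 1), ((n * R + δ p) / (n + 1)) ^ (2 * r + 2)) / n
      ≤ (∑ p ∈ Finset.range (m + 1), (R ^ (2 * r + 2) +
          (2 * r + 2) * R ^ (2 * r + 1) * ((δ p - R) / (n + 1)) +
          (K * w * R ^ (2 * r + 2) + c * (δ p ^ (2 * r + 2) + R ^ (2 * r + 2))))) / n := by
        gcongr with p _
        exact hpt p
    _ = (1 + K * w + c) * R ^ (2 * r + 2) +
          c * ((∑ p ∈ Finset.range (m + 1), δ p ^ (2 * r + 2)) / n) := by
        rw [Finset.sum_add_distrib, Finset.sum_add_distrib, Finset.sum_add_distrib,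
          ← Finset.mul_sum, hlin, ← Finset.mul_sum, ← Finset.mul_sum, Finset.sum_add_distrib, Finset.sum_const,
          Finset.card_range, nsmul_eq_mul, Nat.cast_add_one, ← hn]
        field_simp
        ring
    _ ≤ (1 + K * w + 2 * K * K * w) * R ^ (2 * r + 2) +
          c * (C₁ * C₂ * n ^ (1 / 4 : ℝ) * depthMean m j) := by gcongr
    _ = (1 + K * w + 2 * K * K * w) * R ^ (2 * r + 2) +
          (C₁ * C₂ * depthMean m j) * (c * n ^ (1 / 4 : ℝ)) := by ring
    _ ≤ (1 + K * w + 2 * K * K * w) * R ^ (2 * r + 2) +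
          (C₁ * C₂ * depthMean m j) * (2 * K * K * w * (n ^ (1 / 4 : ℝ))⁻¹) := by gcongr
    _ ≤ _ := by
        have e1 : 0 ≤ 2 * K * K * (C₁ * C₂) * w * R ^ (2 * r + 2) := by positivity
        have e2 : 0 ≤ (K + 2 * K * K) * w * (n ^ (1 / 4 : ℝ))⁻¹ * depthMean m j := by positivity
        linear_combination e1 + e2

section

variable {Ω : Type*} [MeasurableSpace Ω] {P : Measure Ω} [IsProbabilityMeasure P]
  {J : ∀ k : ℕ, Ω → Fin (k + 1)}

/-- Uniform moment bounds: the even moments of the outer sums are small, uniformly in time, if the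
outer sum vanishes up to a late time. -/
theorem exists_integral_outerSum_pow_le (hJ : IsRandomRecursive P J) (r : ℕ) :
    ∃ ε : ℕ → ℝ, Tendsto ε atTop (𝓝 0) ∧ ∀ (t : Set Node) (k : ℕ),
      (∀ m ≤ k, ∀ j, outerSum t m j = 0) → ∀ m,
      ∫ ω, (outerSum t m (code J ω) / ((m : ℝ) + 1)) ^ (2 * r + 2) ∂P ≤ ε k := by
  obtain ⟨C, hC, hstep⟩ := stepAvg_outerSum_pow_le r
  refine ⟨fun k => Real.exp (C * ∑' l, weight (l + k)) - 1, ?_, fun t k h0 => ?_⟩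
  · have h1 := tendsto_sum_nat_add weight
    have h2 : Tendsto (fun k => Real.exp (C * ∑' l, weight (l + k)) - 1) atTop
        (𝓝 (Real.exp (C * 0) - 1)) :=
      ((Real.continuous_exp.tendsto _).comp (h1.const_mul C)).sub_const 1
    simpa using h2
  set e : ℕ → ℝ := fun m =>
    ∫ ω, (outerSum t m (code J ω) / ((m : ℝ) + 1)) ^ (2 * r + 2) ∂P with he
  have hdep : ∀ m, DependsOnPast m
      fun j => (outerSum t m j / ((m : ℝ) + 1)) ^ (2 * r + 2) := by
    intro m j j' h
    simp only
    rw [outerSum_congr t h]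
  have hrec : ∀ m, e (m + 1) ≤ (1 + C * weight m) * e m + C * weight m := by
    intro m
    have hm2 : ((m + 1 : ℕ) : ℝ) + 1 = (m : ℝ) + 2 := by push_cast; ring
    have h1 := hdep (m + 1)
    rw [hm2] at h1
    have hq0 : 0 < ((m : ℝ) + 1) ^ (1 / 4 : ℝ) := by positivity
    have hw := weight_pos m
    simp only [he]
    rw [hm2, integral_stepAvg hJ h1]
    have hi1 := ((hdep m).integrable hJ).const_mul (1 + C * weight m)
    have hi2 := ((depthMean_dependsOnPast m).integrable hJ).const_mul
      (C * weight m * (((m : ℝ) + 1) ^ (1 / 4 : ℝ))⁻¹)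
    refine (integral_mono (h1.stepAvg.integrable hJ) (hi1.add hi2) fun ω =>
      hstep t m (code J ω)).trans ?_
    simp only [Pi.add_apply]
    rw [integral_add hi1 hi2, integral_const_mul, integral_const_mul]
    have h2 : C * weight m * (((m : ℝ) + 1) ^ (1 / 4 : ℝ))⁻¹ *
        ∫ ω, depthMean m (code J ω) ∂P ≤ C * weight m := by
      calc _ ≤ C * weight m * (((m : ℝ) + 1) ^ (1 / 4 : ℝ))⁻¹ * ((m : ℝ) + 1) ^ (1 / 4 : ℝ) := by
            gcongr
            exact integral_depthMean_le hJ m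
        _ = C * weight m := by field_simp
    linarith
  have hek : ∀ m ≤ k, e m = 0 := by
    intro m hm
    simp [he, h0 m hm]
  -- The recursion says that `e + 1` grows at most by the factor `1 + C * weight`, and `e k = 0`.
  have hmain : ∀ m, e (k + m) + 1 ≤ Real.exp (C * ∑ l ∈ Finset.range m, weight (l + k)) := by
    intro m
    induction m with
    | zero => simp [hek k le_rfl]
    | succ m ih =>
      have hw := weight_pos (k + m)
      calc e (k + (m + 1)) + 1 ≤ (1 + C * weight (k + m)) * (e (k + m) + 1) := by
            have := hrec (k + m)
            rw [← add_assoc]; linarith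
        _ ≤ Real.exp (C * weight (k + m)) *
            Real.exp (C * ∑ l ∈ Finset.range m, weight (l + k)) := by
            have := Real.add_one_le_exp (C * weight (k + m))
            have h1 : 0 ≤ 1 + C * weight (k + m) := by positivity
            have h2 : 1 + C * weight (k + m) ≤ Real.exp (C * weight (k + m)) := by linarith
            exact (mul_le_mul_of_nonneg_left ih h1).trans
              (mul_le_mul_of_nonneg_right h2 (Real.exp_nonneg _))
        _ = _ := by
            rw [← Real.exp_add, Finset.sum_range_succ, add_comm m k]
            congr 1; ring
  have hsum : Summable fun l => weight (l + k) := (summable_nat_add_iff k).mpr summable_weight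
  intro m
  change e m ≤ _
  rcases le_total m k with hm | hm
  · rw [hek m hm, sub_nonneg]
    exact Real.one_le_exp (mul_nonneg hC (tsum_nonneg fun l => (weight_pos _).le))
  · obtain ⟨d, rfl⟩ := Nat.exists_eq_add_of_le hm
    have h1 := hmain d
    have h2 : Real.exp (C * ∑ l ∈ Finset.range d, weight (l + k)) ≤
        Real.exp (C * ∑' l, weight (l + k)) := by
      gcongr
      exact hsum.sum_le_tsum _ fun l _ => (weight_pos _).le
    linarith

end

/-! ### Almost sure limits of subtree fractions and node terms -/

theorem isUrnHarmonic_frac : IsUrnHarmonic fun m B => (B : ℝ) / ((m : ℝ) + 1) where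
  harmonic m B _ _ := by push_cast; field_simp; ring
  nonneg m B _ _ := by positivity

/-- A discrete version of `-s log s` for the fraction `s = B / (m + 1)`, with the exact martingale
property. -/
theorem isUrnHarmonic_entropy :
    IsUrnHarmonic fun m B => (B : ℝ) / ((m : ℝ) + 1) * (harm (m + 1) - harm B) where
  harmonic m B _ _ := by
    simp only [harm_succ]
    push_cast
    field_simp
    ring
  nonneg m B _ h := mul_nonneg (by positivity) (sub_nonneg.mpr (harm_mono h))

/-- A discrete version of `-log s`. Its convergence to a finite limit keeps the fraction away from
zero. -/
theorem isUrnHarmonic_log : IsUrnHarmonic fun m B => harm m - harm (B - 1) where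
  harmonic m B hB _ := by
    obtain ⟨b, rfl⟩ := Nat.exists_eq_add_of_le' hB
    simp only [harm_succ, Nat.add_sub_cancel]
    push_cast
    field_simp
    ring
  nonneg m B _ h := sub_nonneg.mpr (harm_mono (by omega))

theorem exists_harm_div_le : ∃ C : ℝ, 0 ≤ C ∧ ∀ m : ℕ,
    harm (m + 1) / ((m : ℝ) + 1) ≤ C * (√((m : ℝ) + 1))⁻¹ := by
  obtain ⟨C, hC, h⟩ := exists_harm_pow_le 1
  refine ⟨C, hC, fun m => ?_⟩
  have hm : (1 : ℝ) ≤ (m : ℝ) + 1 := by have := Nat.cast_nonneg (α := ℝ) m; linarith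
  have h1 : harm (m + 1) ≤ C * √((m : ℝ) + 1) := by
    have h2 : ((m : ℝ) + 1) ^ (1 / 4 : ℝ) ≤ √((m : ℝ) + 1) := by
      rw [Real.sqrt_eq_rpow]
      exact Real.rpow_le_rpow_of_exponent_le hm (by norm_num)
    have h3 := h m
    rw [pow_one] at h3
    have := mul_le_mul_of_nonneg_left h2 hC
    linarith
  rw [div_le_iff₀ (by linarith), mul_assoc]
  have h4 : (√((m : ℝ) + 1))⁻¹ * ((m : ℝ) + 1) = √((m : ℝ) + 1) := by
    have h5 := one_le_sqrt_succ m
    have h6 := Real.mul_self_sqrt (show (0 : ℝ) ≤ (m : ℝ) + 1 by linarith)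
    rw [inv_mul_eq_div, div_eq_iff (by linarith), h6]
  rwa [h4]

theorem tendsto_harm_div : Tendsto (fun m : ℕ => harm (m + 1) / ((m : ℝ) + 1)) atTop (𝓝 0) := by
  obtain ⟨C, hC, h⟩ := exists_harm_div_le
  have h1 : Tendsto (fun m : ℕ => (√((m : ℝ) + 1))⁻¹) atTop (𝓝 0) :=
    tendsto_inv_atTop_zero.comp (Real.tendsto_sqrt_atTop.comp
      (tendsto_atTop_add_const_right _ _ tendsto_natCast_atTop_atTop))
  have h2 := h1.const_mul C
  rw [mul_zero] at h2
  exact squeeze_zero (fun m => div_nonneg (harm_nonneg _) (by positivity)) h h2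

theorem summable_of_le_inv_sqrt {c : ℕ → ℝ} {C : ℝ} (h0 : ∀ m, 0 ≤ c m)
    (h : ∀ m, c m ≤ C * (√((m : ℝ) + 1))⁻¹) : Summable fun m : ℕ => c m / ((m : ℝ) + 1) := by
  refine Summable.of_nonneg_of_le (fun m => div_nonneg (h0 m) (by positivity)) (fun m => ?_)
    (summable_weight.mul_left C)
  have h5 := one_le_sqrt_succ m
  have h6 := Real.sq_sqrt (show (0 : ℝ) ≤ (m : ℝ) + 1 by positivity)
  rw [weight]
  have h7 : (√((m : ℝ) + 1))⁻¹ ^ 3 = (√((m : ℝ) + 1))⁻¹ / ((m : ℝ) + 1) := by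
    have h8 : √((m : ℝ) + 1) ≠ 0 := by positivity
    rw [eq_div_iff (by positivity)]
    generalize √((m : ℝ) + 1) = s at h6 h8 ⊢
    rw [← h6]
    field_simp
  rw [h7, mul_div_assoc']
  gcongr
  exact h m

theorem inv_sqrt_succ_le (m : ℕ) : (√(((m + 1 : ℕ) : ℝ) + 1))⁻¹ ≤ (√((m : ℝ) + 1))⁻¹ := by
  have := one_le_sqrt_succ m
  gcongr
  linarith

theorem summable_frac_one :
    Summable fun m : ℕ => ((1 : ℕ) : ℝ) / (((m + 1 : ℕ) : ℝ) + 1) / ((m : ℝ) + 1) := by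
  obtain ⟨C, hC, h⟩ := exists_harm_div_le
  refine summable_of_le_inv_sqrt (C := C) (fun m => by positivity) fun m => ?_
  refine le_trans ?_ ((h (m + 1)).trans (mul_le_mul_of_nonneg_left (inv_sqrt_succ_le m) hC))
  gcongr
  calc ((1 : ℕ) : ℝ) = harm 1 := by simp [harm_one]
    _ ≤ _ := harm_mono (by omega)

theorem summable_entropy_one :
    Summable fun m : ℕ => ((1 : ℕ) : ℝ) / (((m + 1 : ℕ) : ℝ) + 1) *
      (harm (m + 1 + 1) - harm 1) / ((m : ℝ) + 1) := by
  obtain ⟨C, hC, h⟩ := exists_harm_div_le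
  refine summable_of_le_inv_sqrt (C := C) (fun m => ?_) fun m => ?_
  · exact mul_nonneg (by positivity) (sub_nonneg.mpr (harm_mono (by omega)))
  · refine le_trans ?_ ((h (m + 1)).trans (mul_le_mul_of_nonneg_left (inv_sqrt_succ_le m) hC))
    rw [div_mul_eq_mul_div]
    gcongr
    have := harm_nonneg 1
    push_cast
    linarith

section

variable {Ω : Type*} [MeasurableSpace Ω] {P : Measure Ω} [IsProbabilityMeasure P]
  {J : ∀ k : ℕ, Ω → Fin (k + 1)} {a : ℕ → ℕ → ℝ}

theorem subtreeSize_comp_dependsOnPast (a : ℕ → ℕ → ℝ) (i m : ℕ) :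
    DependsOnPast m fun j => a m (subtreeSize j i m) := by
  intro j j' h
  simp only
  rw [subtreeSize_congr i h]

theorem childSum_dependsOnPast (a : ℕ → ℕ → ℝ) (v L m : ℕ) :
    DependsOnPast m (childSum a v L m) := fun _ _ h => childSum_congr a v L h

/-- A nonnegative martingale has constant mean and is therefore bounded in `L¹`. -/
theorem IsUrnHarmonic.ae_tendsto (hJ : IsRandomRecursive P J) (ha : IsUrnHarmonic a) (i : ℕ) :
    ∀ᵐ ω ∂P, ∃ c, Tendsto (fun m => a m (subtreeSize (code J ω) i m)) atTop (𝓝 c) := by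
  have hE : ∀ m ≥ i, ∫ ω, a m (subtreeSize (code J ω) i m) ∂P =
      ∫ ω, a i (subtreeSize (code J ω) i i) ∂P := by
    intro m hm
    induction m, hm using Nat.le_induction with
    | base => rfl
    | succ m hm ih =>
      rw [← ih, integral_stepAvg hJ (subtreeSize_comp_dependsOnPast a i (m + 1))]
      simp_rw [ha.stepAvg hm]
  refine ae_tendsto_of_le_stepAvg hJ (m₀ := i)
    (g := fun m j => a m (subtreeSize j i m))
    (subtreeSize_comp_dependsOnPast a i) (fun m hm j => (ha.stepAvg hm).ge)
    (C := ∫ ω, a i (subtreeSize (code J ω) i i) ∂P) fun m hm => ?_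
  rw [← hE m hm]
  refine (integral_congr_ae (ae_of_all _ fun ω => abs_of_nonneg ?_)).le
  exact ha.nonneg _ _ (one_le_subtreeSize hm) (subtreeSize_le _ _)

theorem integral_childSum (hJ : IsRandomRecursive P J) (ha : IsUrnHarmonic a) {v L m : ℕ}
    (hv : v ≤ L) (hm : L ≤ m) :
    ∫ ω, childSum a v L m (code J ω) ∂P =
      ∑ l ∈ Finset.Ico L m, a (l + 1) 1 / ((l : ℝ) + 1) := by
  induction m, hm using Nat.le_induction with
  | base => simp [childSum]
  | succ m hm ih =>
    rw [integral_stepAvg hJ (childSum_dependsOnPast a v L (m + 1)), Finset.sum_Ico_succ_top hm,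
      ← ih]
    simp_rw [stepAvg_childSum ha (hv.trans hm) hm]
    rw [integral_add ((childSum_dependsOnPast a v L m).integrable hJ) (integrable_const _)]
    simp

theorem IsUrnHarmonic.one_div_nonneg (ha : IsUrnHarmonic a) (l : ℕ) : 0 ≤ a (l + 1) 1 / ((l : ℝ) + 1) :=
  div_nonneg (ha.nonneg _ _ le_rfl (by omega)) (by positivity)

theorem integral_childSum_le (hJ : IsRandomRecursive P J) (ha : IsUrnHarmonic a)
    (hs : Summable fun l : ℕ => a (l + 1) 1 / ((l : ℝ) + 1)) {v L m : ℕ}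
    (hv : v ≤ L) (hm : L ≤ m) :
    ∫ ω, childSum a v L m (code J ω) ∂P ≤
      ∑' l : ℕ, a (l + L + 1) 1 / (((l + L : ℕ) : ℝ) + 1) := by
  rw [integral_childSum hJ ha hv hm, Finset.sum_Ico_eq_sum_range]
  simp_rw [add_comm L]
  exact ((summable_nat_add_iff L).mpr hs).sum_le_tsum _ fun l _ => IsUrnHarmonic.one_div_nonneg ha _

theorem ae_tendsto_childSum (hJ : IsRandomRecursive P J) (ha : IsUrnHarmonic a)
    (hs : Summable fun l : ℕ => a (l + 1) 1 / ((l : ℝ) + 1)) {v L : ℕ} (hv : v ≤ L) :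
    ∀ᵐ ω ∂P, ∃ c, Tendsto (fun m => childSum a v L m (code J ω)) atTop (𝓝 c) := by
  refine ae_tendsto_of_le_stepAvg hJ (m₀ := L) (g := fun m => childSum a v L m)
    (childSum_dependsOnPast a v L) (fun m hm j => ?_) fun m hm =>
    (integral_congr_ae (ae_of_all _ fun ω =>
      abs_of_nonneg (childSum_nonneg ha v L m _))).le.trans (integral_childSum_le hJ ha hs hv hm)
  rw [stepAvg_childSum ha (hv.trans hm) hm]
  have := ha.nonneg (m + 1) 1 le_rfl (by omega)
  have : 0 ≤ a (m + 1) 1 / ((m : ℝ) + 1) := by positivity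
  linarith

/-- Late children do not contribute to the limit. -/
theorem ae_childSum_tail (hJ : IsRandomRecursive P J) (ha : IsUrnHarmonic a)
    (hs : Summable fun l : ℕ => a (l + 1) 1 / ((l : ℝ) + 1)) (v : ℕ) :
    ∀ᵐ ω ∂P, ∀ ε > 0, ∃ L ≥ v, ∀ c,
      Tendsto (fun m => childSum a v L m (code J ω)) atTop (𝓝 c) → c < ε := by
  -- The lower limit is defined whether or not the limit exists, and Fatou's lemma bounds its mean
  -- by the tail of a convergent series.
  set h : ℕ → Ω → ℝ≥0∞ := fun L ω =>
    liminf (fun m => ENNReal.ofReal (childSum a v (v + L) m (code J ω))) atTop with hh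
  have hmeas : ∀ L m, Measurable fun ω => ENNReal.ofReal (childSum a v (v + L) m (code J ω)) :=
    fun L m => ((childSum_dependsOnPast a v (v + L) m).measurable hJ).ennreal_ofReal
  have hm : ∀ L, Measurable (h L) := fun L => Measurable.liminf (hmeas L)
  have hint : ∀ L, ∫⁻ ω, h L ω ∂P ≤
      ENNReal.ofReal (∑' l : ℕ, a (l + (v + L) + 1) 1 / (((l + (v + L) : ℕ) : ℝ) + 1)) := by
    intro L
    refine (lintegral_liminf_le (hmeas L)).trans ?_
    refine liminf_le_of_frequently_le' (Eventually.frequently ?_)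
    filter_upwards [eventually_ge_atTop (v + L)] with m hm
    rw [← ofReal_integral_eq_lintegral_ofReal
      ((childSum_dependsOnPast a v (v + L) m).integrable hJ)
      (ae_of_all _ fun ω => childSum_nonneg ha v (v + L) m _)]
    exact ENNReal.ofReal_le_ofReal (integral_childSum_le hJ ha hs (by omega) hm)
  -- The means tend to zero in `L`, so the infimum over `L` vanishes almost surely; no single `L`
  -- would do.
  have hzero : ∫⁻ ω, ⨅ L, h L ω ∂P = 0 := by
    have h1 : Tendsto (fun L => ENNReal.ofReal
        (∑' l : ℕ, a (l + (v + L) + 1) 1 / (((l + (v + L) : ℕ) : ℝ) + 1))) atTop (𝓝 0) := by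
      rw [← ENNReal.ofReal_zero]
      refine (ENNReal.continuous_ofReal.tendsto 0).comp ?_
      have h2 := tendsto_sum_nat_add fun l : ℕ => a (l + 1) 1 / ((l : ℝ) + 1)
      exact h2.comp (tendsto_atTop_mono (fun L => Nat.le_add_left L v) tendsto_id)
    refine le_antisymm (ge_of_tendsto' h1 fun L => ?_) (zero_le)
    exact (lintegral_mono fun ω => iInf_le _ L).trans (hint L)
  rw [lintegral_eq_zero_iff (Measurable.iInf hm)] at hzero
  filter_upwards [hzero] with ω hω ε hε
  have h1 : ⨅ L, h L ω < ENNReal.ofReal ε := by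
    rw [hω]; exact ENNReal.ofReal_pos.mpr hε
  obtain ⟨L, hL⟩ := iInf_lt_iff.mp h1
  refine ⟨v + L, by omega, fun c hc => ?_⟩
  have h2 : h L ω = ENNReal.ofReal c :=
    ((ENNReal.continuous_ofReal.tendsto c).comp hc).liminf_eq
  rw [h2] at hL
  exact (ENNReal.ofReal_lt_ofReal_iff hε).mp hL

/-- Exchange of limit and infinite sum. The limit of `childSum` from `L` on is `z` minus the first
`L` limit terms; it is nonnegative, and small for some `L` by the tail bound. The summands being
nonnegative, their sum is `z`. -/
theorem ae_hasSum_children (hJ : IsRandomRecursive P J) (ha : IsUrnHarmonic a)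
    (hs : Summable fun l : ℕ => a (l + 1) 1 / ((l : ℝ) + 1)) (v : ℕ) :
    ∀ᵐ ω ∂P, ∀ α : ℕ → ℝ,
      (∀ i, Tendsto (fun m => a m (subtreeSize (code J ω) i m)) atTop (𝓝 (α i))) →
      ∃ z, Tendsto (fun m => childSum a v v m (code J ω)) atTop (𝓝 z) ∧
        HasSum (fun l => if (J l ω : ℕ) = v then α (l + 1) else 0) z := by
  have h1 : ∀ᵐ ω ∂P, ∃ z, Tendsto (fun m => childSum a v v m (code J ω)) atTop (𝓝 z) :=
    ae_tendsto_childSum hJ ha hs le_rfl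
  filter_upwards [h1, ae_childSum_tail hJ ha hs v] with ω ⟨z, hz⟩ htail α hα
  refine ⟨z, hz, ?_⟩
  set f : ℕ → ℝ := fun l => if (J l ω : ℕ) = v then α (l + 1) else 0 with hf
  have hα0 : ∀ i, 0 ≤ α i := fun i => ge_of_tendsto (hα i) <| by
    filter_upwards [eventually_ge_atTop i] with m hm
    exact ha.nonneg _ _ (one_le_subtreeSize hm) (subtreeSize_le _ _)
  have hf0 : ∀ l, 0 ≤ f l := fun l => by
    simp only [hf]; split_ifs
    · exact hα0 _
    · exact le_rfl
  have hlow : ∀ l < v, f l = 0 := by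
    intro l hl
    have := (J l ω).isLt
    exact if_neg (by omega)
  have htends : ∀ L ≥ v, Tendsto (fun m => childSum a v L m (code J ω)) atTop
      (𝓝 (z - ∑ l ∈ Finset.range L, f l)) := by
    intro L hL
    have h2 : Tendsto (fun m => ∑ l ∈ Finset.Ico v L, if (code J ω l : ℕ) = v then
        a m (subtreeSize (code J ω) (l + 1) m) else 0) atTop
        (𝓝 (∑ l ∈ Finset.Ico v L, f l)) := by
      refine tendsto_finsetSum _ fun l _ => ?_
      by_cases h : (J l ω : ℕ) = v
      · simp only [hf, h, code, if_true]
        exact hα (l + 1)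
      · simp [hf, h, code]
    have h3 : ∑ l ∈ Finset.range L, f l = ∑ l ∈ Finset.Ico v L, f l := by
      rw [← Finset.sum_range_add_sum_Ico _ hL, Finset.sum_eq_zero fun l hl =>
        hlow l (Finset.mem_range.mp hl), zero_add]
    rw [h3]
    refine (hz.sub h2).congr' ?_
    filter_upwards [eventually_ge_atTop L] with m hm
    rw [childSum, childSum, ← Finset.sum_Ico_consecutive _ hL hm]
    ring
  rw [hasSum_iff_tendsto_nat_of_nonneg hf0]
  have hmono : Monotone fun L => ∑ l ∈ Finset.range L, f l := fun L L' h =>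
    Finset.sum_le_sum_of_subset_of_nonneg (Finset.range_subset_range.mpr h) fun l _ _ => hf0 l
  have hle : ∀ L ≥ v, ∑ l ∈ Finset.range L, f l ≤ z := fun L hL =>
    sub_nonneg.mp (ge_of_tendsto' (htends L hL) fun m => childSum_nonneg ha _ _ _ _)
  refine tendsto_atTop_isLUB hmono ⟨?_, fun b hb => ?_⟩
  · rintro _ ⟨L, rfl⟩
    exact (hmono (le_max_left L v)).trans (hle _ (le_max_right L v))
  · refine le_of_forall_pos_le_add fun ε hε => ?_
    obtain ⟨L, hL, h⟩ := htail ε hε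
    have h4 := h _ (htends L hL)
    have h5 := hb ⟨L, rfl⟩
    simp only at h5
    linarith

/-- The subtree fractions have positive limits. -/
theorem ae_exists_mass (hJ : IsRandomRecursive P J) (i : ℕ) :
    ∀ᵐ ω ∂P, ∃ x : ℝ, 0 < x ∧
      Tendsto (fun m : ℕ => (subtreeSize (code J ω) i m : ℝ) / ((m : ℝ) + 1)) atTop (𝓝 x) := by
  filter_upwards [isUrnHarmonic_frac.ae_tendsto hJ i, isUrnHarmonic_log.ae_tendsto hJ i]
    with ω ⟨x, hx⟩ ⟨c, hc⟩
  refine ⟨x, ?_, hx⟩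
  -- From `H_m - H_{B-1} ≤ c + 1`, `log (m + 1) ≤ H_m` and `H_{B-1} ≤ 1 + log B`.
  have hev : ∀ᶠ m in atTop, Real.exp (-(c + 2)) ≤
      (subtreeSize (code J ω) i m : ℝ) / ((m : ℝ) + 1) := by
    filter_upwards [hc.eventually_le_const (lt_add_one c), eventually_ge_atTop i] with m hm hi
    set B := subtreeSize (code J ω) i m with hB
    have hB1 : 1 ≤ B := one_le_subtreeSize hi
    have hB0 : (0 : ℝ) < B := by exact_mod_cast hB1
    have h1 : Real.log ((m : ℝ) + 1) ≤ harm m := by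
      have := log_add_one_le_harmonic m
      push_cast at this
      exact this
    have h2 : harm (B - 1) ≤ 1 + Real.log B :=
      (harm_mono (Nat.sub_le B 1)).trans (harmonic_le_one_add_log B)
    rw [← Real.le_log_iff_exp_le (by positivity), Real.log_div hB0.ne' (by positivity)]
    linarith
  exact (Real.exp_pos _).trans_le (ge_of_tendsto hx hev)

end

/-- As `x > 0`, also `B m → ∞`; Euler's constant then enters through both harmonic numbers and
cancels. -/
theorem tendsto_entropy {B : ℕ → ℕ} {x : ℝ} (hx : 0 < x)
    (h : Tendsto (fun m : ℕ => (B m : ℝ) / ((m : ℝ) + 1)) atTop (𝓝 x)) :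
    Tendsto (fun m : ℕ => (B m : ℝ) / ((m : ℝ) + 1) * (harm (m + 1) - harm (B m))) atTop
      (𝓝 (-(x * Real.log x))) := by
  have hm : Tendsto (fun m : ℕ => (m : ℝ) + 1) atTop atTop :=
    tendsto_atTop_add_const_right _ _ tendsto_natCast_atTop_atTop
  have hB : Tendsto B atTop atTop := by
    rw [← tendsto_natCast_atTop_iff (R := ℝ)]
    refine (h.pos_mul_atTop hx hm).congr fun m => ?_
    field_simp
  have h1 : Tendsto (fun m : ℕ => harm (m + 1) - Real.log ((m : ℝ) + 1)) atTop
      (𝓝 Real.eulerMascheroniConstant) := by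
    have := Real.tendsto_harmonic_sub_log.comp (tendsto_add_atTop_nat 1)
    refine this.congr fun m => ?_
    simp [harm]
  have h2 : Tendsto (fun m : ℕ => harm (B m) - Real.log (B m)) atTop
      (𝓝 Real.eulerMascheroniConstant) := Real.tendsto_harmonic_sub_log.comp hB
  have h3 : Tendsto (fun m : ℕ => Real.log ((B m : ℝ) / ((m : ℝ) + 1))) atTop
      (𝓝 (Real.log x)) := h.log hx.ne'
  have h4 : Tendsto (fun m : ℕ => harm (m + 1) - harm (B m)) atTop (𝓝 (-Real.log x)) := by
    have := (h1.sub h2).sub h3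
    rw [sub_self, zero_sub] at this
    refine this.congr' ?_
    filter_upwards [hB.eventually_ge_atTop 1] with m hm
    have hB0 : (0 : ℝ) < B m := by exact_mod_cast hm
    rw [Real.log_div hB0.ne' (by positivity)]
    ring
  have := h.mul h4
  rwa [mul_neg] at this

/-- The children of `v` have total size `S_v - 1`, so inserting `H_{m+1}` everywhere costs only
`H_{m+1} / (m + 1)`. What remains are urn-harmonic functions. -/
theorem nodeTerm_div {j : TreeCode} {v m : ℕ} (hv : v ≤ m) :
    nodeTerm j v m / ((m : ℝ) + 1) =
      (subtreeSize j v m : ℝ) / ((m : ℝ) + 1) +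
      (subtreeSize j v m : ℝ) / ((m : ℝ) + 1) * (harm (m + 1) - harm (subtreeSize j v m)) -
      childSum (fun m B => (B : ℝ) / ((m : ℝ) + 1) * (harm (m + 1) - harm B)) v v m j -
      harm (m + 1) / ((m : ℝ) + 1) := by
  have hB : ∑ l ∈ Finset.range m, (if (j l : ℕ) = v then (subtreeSize j (l + 1) m : ℝ) else 0) + 1 =
      subtreeSize j v m := by
    exact_mod_cast sum_children_subtreeSize hv
  have hc : childSum (fun m B => (B : ℝ) / ((m : ℝ) + 1) * (harm (m + 1) - harm B)) v v m j =
      (harm (m + 1) * ∑ l ∈ Finset.range m,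
        (if (j l : ℕ) = v then (subtreeSize j (l + 1) m : ℝ) else 0) -
      ∑ l ∈ Finset.range m, if (j l : ℕ) = v then
        subtreeSize j (l + 1) m * harm (subtreeSize j (l + 1) m) else 0) / ((m : ℝ) + 1) := by
    have h0 : ∀ f : ℕ → ℝ, ∑ l ∈ Finset.Ico v m, (if (j l : ℕ) = v then f l else 0) =
        ∑ l ∈ Finset.range m, (if (j l : ℕ) = v then f l else 0) := by
      intro f
      rw [← Finset.sum_range_add_sum_Ico _ hv, Finset.sum_eq_zero (s := Finset.range v), zero_add]
      intro l hl
      have := (j l).isLt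
      have := Finset.mem_range.mp hl
      exact if_neg (by omega)
    rw [childSum, h0, Finset.mul_sum, ← Finset.sum_sub_distrib, Finset.sum_div]
    refine Finset.sum_congr rfl fun l _ => ?_
    split_ifs
    · ring
    · simp
  rw [hc, nodeTerm, ← hB]
  field_simp
  ring

/-- The almost sure properties of the code of a random recursive tree, with limit masses `x`. -/
structure IsGoodCode (j : TreeCode) (x : ℕ → ℝ) : Prop where
  infinite : ∀ p : ℕ, {k : ℕ | (j k : ℕ) = p}.Infinite
  pos : ∀ i, 0 < x i
  tendsto : ∀ i, Tendsto (fun m : ℕ => (subtreeSize j i m : ℝ) / ((m : ℝ) + 1)) atTop (𝓝 (x i))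
  hasSum : ∀ v, HasSum (fun l => if (j l : ℕ) = v then x (l + 1) else 0) (x v)
  nodeTerm : ∀ v, ∃ z,
    HasSum (fun l => if (j l : ℕ) = v then x (l + 1) * Real.log (x (l + 1)) else 0) z ∧
    Tendsto (fun m : ℕ => nodeTerm j v m / ((m : ℝ) + 1)) atTop
      (𝓝 (x v - x v * Real.log (x v) + z))

/-- All almost sure statements on single nodes and their children are gathered here; identifying the
limits is then a matter of one fixed code. -/
theorem ae_isGoodCode {Ω : Type*} [MeasurableSpace Ω] {P : Measure Ω} [IsProbabilityMeasure P]
    {J : ∀ k : ℕ, Ω → Fin (k + 1)} (hJ : IsRandomRecursive P J) :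
    ∀ᵐ ω ∂P, ∃ x, IsGoodCode (code J ω) x := by
  filter_upwards [ae_infinite_children hJ, ae_all_iff.mpr (ae_exists_mass hJ),
    ae_all_iff.mpr (ae_hasSum_children hJ isUrnHarmonic_frac summable_frac_one),
    ae_all_iff.mpr (ae_hasSum_children hJ isUrnHarmonic_entropy summable_entropy_one)]
    with ω hinf hmass hfrac hent
  choose x hx0 hx using hmass
  refine ⟨x, hinf, hx0, hx, fun v => ?_, fun v => ?_⟩
  · obtain ⟨z, hz, hsum⟩ := hfrac v x hx
    have h1 : Tendsto (fun m : ℕ => (subtreeSize (code J ω) v m : ℝ) / ((m : ℝ) + 1) -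
        1 / ((m : ℝ) + 1)) atTop (𝓝 (x v - 0)) :=
      (hx v).sub tendsto_one_div_add_atTop_nhds_zero_nat
    rw [sub_zero] at h1
    -- The children of `v` miss only `v` itself, a fraction `1 / (m + 1)` that vanishes in the
    -- limit.
    have h2 : z = x v := by
      refine tendsto_nhds_unique hz (h1.congr' ?_)
      filter_upwards [eventually_ge_atTop v] with m hm
      rw [childSum, ← sum_children_subtreeSize hm, ← Finset.sum_subset
        (show Finset.Ico v m ⊆ Finset.range m from fun l hl =>
          Finset.mem_range.mpr (Finset.mem_Ico.mp hl).2)]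
      · push_cast
        rw [← sub_div, add_sub_cancel_right, Finset.sum_div]
        refine Finset.sum_congr rfl fun l _ => ?_
        split_ifs <;> simp
      · intro l hl hl'
        have := (code J ω l).isLt
        have := Finset.mem_range.mp hl
        simp only [Finset.mem_Ico, not_and, not_lt] at hl'
        exact if_neg (by omega)
    exact h2 ▸ hsum
  · obtain ⟨z, hz, hsum⟩ := hent v (fun i => -(x i * Real.log (x i))) fun i =>
      tendsto_entropy (hx0 i) (hx i)
    refine ⟨-z, ?_, ?_⟩
    · have h0 : (fun l => if (code J ω l : ℕ) = v then x (l + 1) * Real.log (x (l + 1)) else 0) =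
          fun l => -(if (J l ω : ℕ) = v then -(x (l + 1) * Real.log (x (l + 1))) else 0) := by
        funext l
        by_cases h : (J l ω : ℕ) = v <;> simp [h, code]
      rw [h0]
      exact hsum.neg
    · have h1 := (((hx v).add (tendsto_entropy (hx0 v) (hx v))).sub hz).sub tendsto_harm_div
      rw [sub_zero, ← sub_eq_add_neg, sub_eq_add_neg _ z] at h1
      refine h1.congr' ?_
      filter_upwards [eventually_ge_atTop v] with m hm
      rw [nodeTerm_div hm]

/-! ### Cylinder sets and the construction of the limit measure -/

theorem isPrefixOf_inf_concat (u : Node) (a : ℕ+) (s : ℕ → ℕ+) :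
    IsPrefixOf (u ++ [a]) (NodeBar.inf s) ↔ IsPrefixOf u (NodeBar.inf s) ∧ a = s u.length := by
  simp only [IsPrefixOf]
  constructor
  · intro h
    refine ⟨fun i hi => ?_, ?_⟩
    · have := h i (by simp; omega)
      rwa [List.getElem_append_left hi] at this
    · have := h u.length (by simp)
      simpa using this
  · rintro ⟨h1, h2⟩ i hi
    rcases lt_or_ge i u.length with hlt | hge
    · rw [List.getElem_append_left hlt, h1 i hlt]
    · have hi' : i = u.length := by simp at hi; omega
      subst hi'
      simpa using h2

theorem measurableSet_cyl (u : Node) : MeasurableSet (cyl u) :=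
  MeasurableSpace.measurableSet_generateFrom ⟨u, rfl⟩

theorem cyl_concat_subset (u : Node) (i : ℕ+) : cyl (u ++ [i]) ⊆ cyl u := by
  intro v hv
  cases v with
  | fin l => exact (List.prefix_append u [i]).trans hv
  | inf s => exact ((isPrefixOf_inf_concat u i s).mp hv).1
  | pad l => exact (List.prefix_append u [i]).trans hv

theorem disjoint_cyl_concat (u : Node) {i k : ℕ+} (h : i ≠ k) :
    Disjoint (cyl (u ++ [i])) (cyl (u ++ [k])) := by
  have key : ∀ l : Node, u ++ [i] <+: l → u ++ [k] <+: l → False := by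
    intro l h1 h2
    have h3 := (List.prefix_of_prefix_length_le h1 h2 (by simp)).eq_of_length (by simp)
    exact h (List.cons.inj (List.append_cancel_left h3)).1
  rw [Set.disjoint_left]
  intro v h1 h2
  cases v with
  | fin l => exact key l h1 h2
  | inf s =>
    exact h (((isPrefixOf_inf_concat u i s).mp h1).2.trans
      ((isPrefixOf_inf_concat u k s).mp h2).2.symm)
  | pad l => exact key l h1 h2

/-- If the masses of the children of `u` add up to the mass of `u`, then `u` is not an atom. -/
theorem measure_fin_eq_zero (μ : ProbabilityMeasure NodeBar) (u : Node)
    (h : HasSum (fun i : ℕ+ => (μ : Measure NodeBar).real (cyl (u ++ [i])))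
      ((μ : Measure NodeBar).real (cyl u))) :
    (μ : Measure NodeBar) {NodeBar.fin u} = 0 := by
  have hsub : ({NodeBar.fin u} : Set NodeBar) ⊆ cyl u \ ⋃ i : ℕ+, cyl (u ++ [i]) := by
    rintro _ rfl
    refine ⟨List.prefix_refl u, ?_⟩
    simp only [Set.mem_iUnion, not_exists]
    intro i hi
    have := List.IsPrefix.length_le (show u ++ [i] <+: u from hi)
    simp at this
  have hmeas : MeasurableSet (⋃ i : ℕ+, cyl (u ++ [i])) :=
    MeasurableSet.iUnion fun i => measurableSet_cyl _
  have hU : (μ : Measure NodeBar) (⋃ i : ℕ+, cyl (u ++ [i])) = (μ : Measure NodeBar) (cyl u) := by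
    rw [measure_iUnion (fun i k hik => disjoint_cyl_concat u hik) fun i => measurableSet_cyl _]
    have h1 : ∀ s, (μ : Measure NodeBar) s = ENNReal.ofReal ((μ : Measure NodeBar).real s) :=
      fun s => (ofReal_measureReal).symm
    rw [h1 (cyl u), ← h.tsum_eq, ENNReal.ofReal_tsum_of_nonneg (fun _ => measureReal_nonneg)
      h.summable]
    exact tsum_congr fun i => h1 _
  refine measure_mono_null hsub ?_
  rw [measure_sdiff (Set.iUnion_subset fun i => cyl_concat_subset u i) hmeas.nullMeasurableSet
    (measure_ne_top _ _), hU, tsub_self]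

section Construction

variable (y : Node → ℝ)

/-- The total mass of the first `n` children of `u`. -/
noncomputable def childrenMass (u : Node) (n : ℕ) : ℝ :=
  ∑ k ∈ Finset.range n, y (u ++ [k.succPNat])

open Classical in
/-- The (zero-based) index of the child of `u` selected by the residual `r`. -/
noncomputable def nextChild (u : Node) (r : ℝ) : ℕ :=
  if h : ∃ n, r < childrenMass y u (n + 1) then Nat.find h else 0

/-- The word and the residual after `n` steps of the interval subdivision, started with `r`. -/
noncomputable def subdivision (r : ℝ) : ℕ → Node × ℝ
  | 0 => ([], r)
  | n + 1 =>
    let c := subdivision r n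
    (c.1 ++ [(nextChild y c.1 c.2).succPNat], c.2 - childrenMass y c.1 (nextChild y c.1 c.2))

/-- The infinite word selected by `r`. -/
noncomputable def subdivisionWord (r : ℝ) (n : ℕ) : ℕ+ :=
  (nextChild y (subdivision y r n).1 (subdivision y r n).2).succPNat

variable {y}

theorem subdivision_eq_concat_iff (r : ℝ) (u : Node) (a : ℕ+) :
    (subdivision y r (u ++ [a]).length).1 = u ++ [a] ↔
      (subdivision y r u.length).1 = u ∧ a = subdivisionWord y r u.length := by
  rw [List.length_append, List.length_singleton]
  simp only [subdivision, subdivisionWord]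
  constructor
  · intro h
    obtain ⟨h1, h2⟩ := List.append_inj' h rfl
    exact ⟨h1, (List.cons.inj h2).1.symm⟩
  · rintro ⟨h1, h2⟩
    rw [← h2, h1]

theorem isPrefixOf_subdivisionWord (r : ℝ) (u : Node) :
    IsPrefixOf u (NodeBar.inf (subdivisionWord y r)) ↔ (subdivision y r u.length).1 = u := by
  induction u using List.reverseRecOn with
  | nil => simp [IsPrefixOf, subdivision]
  | append_singleton u a ih => rw [isPrefixOf_inf_concat, ih, subdivision_eq_concat_iff]

/-- The cumulative masses of the children increase to `y u`, so `[0, y u)` is partitioned into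
consecutive intervals, one for each child. -/
theorem nextChild_eq_iff (hpos : ∀ u, 0 < y u)
    (hsum : ∀ u, HasSum (fun i : ℕ+ => y (u ++ [i])) (y u)) {u : Node} {r : ℝ}
    (h0 : 0 ≤ r) (h1 : r < y u) (n : ℕ) :
    nextChild y u r = n ↔ childrenMass y u n ≤ r ∧ r < childrenMass y u (n + 1) := by
  have hmono : Monotone (childrenMass y u) := monotone_nat_of_le_succ fun k => by
    rw [childrenMass, childrenMass, Finset.sum_range_succ]
    have := hpos (u ++ [k.succPNat])
    linarith
  have htend : Tendsto (childrenMass y u) atTop (𝓝 (y u)) := by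
    have := (Equiv.pnatEquivNat.symm.hasSum_iff).mpr (hsum u)
    exact this.tendsto_sum_nat
  have hex : ∃ n, r < childrenMass y u (n + 1) :=
    (((tendsto_add_atTop_iff_nat 1).mpr htend).eventually_const_lt h1).exists
  rw [nextChild, dif_pos hex, Nat.find_eq_iff]
  constructor
  · rintro ⟨h2, h3⟩
    refine ⟨?_, h2⟩
    cases n with
    | zero => simpa [childrenMass] using h0
    | succ n => exact not_lt.mp (h3 n (Nat.lt_succ_self n))
  · rintro ⟨h2, h3⟩
    exact ⟨h3, fun k hk => not_lt.mpr ((hmono hk).trans h2)⟩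

/-- The set of starting points that select a word with prefix `u` is an interval of length `y u`. -/
theorem exists_interval (hnil : y [] = 1) (hpos : ∀ u, 0 < y u)
    (hsum : ∀ u, HasSum (fun i : ℕ+ => y (u ++ [i])) (y u)) (u : Node) :
    ∃ a, 0 ≤ a ∧ a + y u ≤ 1 ∧ ∀ r ∈ Set.Ico (0 : ℝ) 1,
      ((subdivision y r u.length).1 = u ↔ r ∈ Set.Ico a (a + y u)) ∧
      ((subdivision y r u.length).1 = u → (subdivision y r u.length).2 = r - a) := by
  induction u using List.reverseRecOn with
  | nil =>
    refine ⟨0, le_rfl, by rw [hnil]; norm_num, fun r hr => ?_⟩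
    simpa [subdivision, hnil] using hr
  | append_singleton u i ih =>
    obtain ⟨a, ha0, ha1, h⟩ := ih
    obtain ⟨n, rfl⟩ : ∃ n : ℕ, i = n.succPNat := ⟨i.natPred, (PNat.succPNat_natPred i).symm⟩
    have hc0 : 0 ≤ childrenMass y u n := Finset.sum_nonneg fun k _ => (hpos _).le
    have hc1 : childrenMass y u n + y (u ++ [n.succPNat]) = childrenMass y u (n + 1) := by
      rw [childrenMass, childrenMass, Finset.sum_range_succ]
    have hc2 : childrenMass y u (n + 1) ≤ y u := by
      have h1 := (Equiv.pnatEquivNat.symm.hasSum_iff).mpr (hsum u)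
      exact sum_le_hasSum _ (fun k _ => (hpos _).le) h1
    -- The interval of a child starts after those of its elder siblings.
    refine ⟨a + childrenMass y u n, by positivity, by linarith, fun r hr => ?_⟩
    obtain ⟨h1, h2⟩ := h r hr
    have key : (subdivision y r u.length).1 = u →
        (nextChild y u (r - a) = n ↔ r ∈ Set.Ico (a + childrenMass y u n)
          (a + childrenMass y u n + y (u ++ [n.succPNat]))) := by
      intro hu
      have hr' := h1.mp hu
      rw [nextChild_eq_iff hpos hsum (by linarith [hr'.1]) (by linarith [hr'.2]), Set.mem_Ico,
        add_assoc, hc1]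
      constructor
      · rintro ⟨h3, h4⟩; constructor <;> linarith
      · rintro ⟨h3, h4⟩; constructor <;> linarith
    have hword : (subdivision y r u.length).1 = u →
        subdivisionWord y r u.length = (nextChild y u (r - a)).succPNat := by
      intro hu
      rw [subdivisionWord, hu, h2 hu]
    constructor
    · rw [subdivision_eq_concat_iff]
      constructor
      · rintro ⟨hu, h3⟩
        rw [hword hu] at h3
        exact (key hu).mp (Nat.succPNat_injective h3).symm
      · intro h3
        have hu : (subdivision y r u.length).1 = u := by
          rw [h1]
          exact ⟨by linarith [h3.1], by linarith [h3.2]⟩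
        refine ⟨hu, ?_⟩
        rw [hword hu, (key hu).mpr h3]
    · intro h3
      obtain ⟨hu, h4⟩ := (subdivision_eq_concat_iff r u _).mp h3
      rw [hword hu] at h4
      have h5 := (Nat.succPNat_injective h4).symm
      rw [List.length_append, List.length_singleton]
      simp only [subdivision]
      rw [hu, h2 hu, h5]
      ring

/-- Consistent masses are the masses of a probability measure on the enlarged node set. -/
theorem exists_probabilityMeasure_cyl (hnil : y [] = 1) (hpos : ∀ u, 0 < y u)
    (hsum : ∀ u, HasSum (fun i : ℕ+ => y (u ++ [i])) (y u)) :
    ∃ μ : ProbabilityMeasure NodeBar, ∀ u, (μ : Measure NodeBar).real (cyl u) = y u := by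
  choose a ha0 ha1 ha using exists_interval hnil hpos hsum
  -- The measure is the image of the uniform distribution on `[0, 1)`; `Int.fract` brings every real
  -- argument into the range where the subdivision is controlled.
  set f : ℝ → NodeBar := fun r => NodeBar.inf (subdivisionWord y (Int.fract r)) with hf
  have hpre : ∀ u, f ⁻¹' cyl u = Int.fract ⁻¹' Set.Ico (a u) (a u + y u) := by
    intro u
    ext r
    have hr : Int.fract r ∈ Set.Ico (0 : ℝ) 1 := ⟨Int.fract_nonneg r, Int.fract_lt_one r⟩
    exact (isPrefixOf_subdivisionWord _ u).trans (ha u _ hr).1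
  have hfm : Measurable f := by
    refine measurable_generateFrom ?_
    rintro _ ⟨u, rfl⟩
    rw [hpre]
    exact measurable_fract measurableSet_Ico
  have hprob : IsProbabilityMeasure (volume.restrict (Set.Ico (0 : ℝ) 1)) := ⟨by simp⟩
  refine ⟨⟨(volume.restrict (Set.Ico (0 : ℝ) 1)).map f,
    Measure.isProbabilityMeasure_map hfm.aemeasurable⟩, fun u => ?_⟩
  have hset : Int.fract ⁻¹' Set.Ico (a u) (a u + y u) ∩ Set.Ico (0 : ℝ) 1 =
      Set.Ico (a u) (a u + y u) := by
    ext r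
    constructor
    · rintro ⟨h1, h2⟩
      rwa [Set.mem_preimage, Int.fract_eq_self.mpr h2] at h1
    · intro h
      have h2 : r ∈ Set.Ico (0 : ℝ) 1 := ⟨(ha0 u).trans h.1, h.2.trans_le (ha1 u)⟩
      exact ⟨by rwa [Set.mem_preimage, Int.fract_eq_self.mpr h2], h2⟩
  change ((volume.restrict (Set.Ico (0 : ℝ) 1)).map f).real (cyl u) = y u
  rw [map_measureReal_apply hfm (measurableSet_cyl u), hpre,
    measureReal_restrict_apply (measurable_fract measurableSet_Ico), hset, Real.volume_real_Ico]
  rw [add_sub_cancel_left, max_eq_left (hpos u).le]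

end Construction

variable {j : TreeCode} {x : ℕ → ℝ}

/-- Sums over the children of `v` as sums over the positive integers. -/
theorem hasSum_children_word {idx : Node → ℕ} (hidx : ∀ u, nodeWord j (idx u) = u) (f : ℕ → ℝ)
    (v : ℕ) {z : ℝ} (h : HasSum (fun l => if (j l : ℕ) = v then f (l + 1) else 0) z) :
    HasSum (fun i : ℕ+ => f (idx (nodeWord j v ++ [i]))) z := by
  have hne : ∀ i : ℕ+, idx (nodeWord j v ++ [i]) ≠ 0 := by
    intro i h0
    have := hidx (nodeWord j v ++ [i])
    rw [h0, nodeWord_zero] at this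
    simp at this
  -- Child number `i` of `v` is node `κ i + 1`; below, `κ` is injective and its range contains all
  -- indices at which a child of `v` is attached.
  choose κ hκ using fun i => Nat.exists_eq_succ_of_ne_zero (hne i)
  have hword : ∀ i, nodeWord j (κ i + 1) = nodeWord j v ++ [i] := fun i => by
    rw [← Nat.succ_eq_add_one, ← hκ, hidx]
  have hpar : ∀ i, (j (κ i) : ℕ) = v := by
    intro i
    have h1 := hword i
    rw [nodeWord_succ] at h1
    exact nodeWord_injective j (List.append_inj' h1 rfl).1
  have hinj : Function.Injective κ := by
    intro i k hik
    have h1 := hword i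
    rw [hik, hword k] at h1
    exact (List.cons.inj (List.append_cancel_left h1)).1.symm
  have hrange : ∀ l ∉ Set.range κ, (if (j l : ℕ) = v then f (l + 1) else 0) = 0 := by
    intro l hl
    refine if_neg fun h1 => hl ?_
    have h2 := nodeWord_succ (j := j) l
    rw [show nodeWord j (j l) = nodeWord j v by rw [h1]] at h2
    exact ⟨_, Nat.succ_injective (nodeWord_injective j ((hword _).trans h2.symm))⟩
  have h3 := (hinj.hasSum_iff hrange).mpr h
  refine h3.congr_fun fun i => ?_
  simp only [Function.comp_apply, hpar, if_true, hκ, Nat.succ_eq_add_one]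

/-! ### Uniform integrability and even moments -/

section Lp

variable {Ω : Type*} [MeasurableSpace Ω] {P : Measure Ω} [IsProbabilityMeasure P]

/-- Hölder's inequality on a set of measure at most `δ` gains the factor `δ ^ θ` with `θ = 1/p - 1/q
> 0`. -/
theorem unifIntegrable_of_eLpNorm_le {f : ℕ → Ω → ℝ} {p q B : ℝ≥0∞} (hp : p ≠ 0) (hpq : p < q)
    (hq : q ≠ ∞) (hf : ∀ n, AEStronglyMeasurable (f n) P) (hB : B ≠ ∞)
    (h : ∀ n, eLpNorm (f n) q P ≤ B) : UnifIntegrable f p P := by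
  intro ε hε
  set θ : ℝ := 1 / p.toReal - 1 / q.toReal with hθ
  have hθ0 : 0 < θ := by
    have h1 : 0 < p.toReal := ENNReal.toReal_pos hp (hpq.trans_le le_top).ne
    have h2 : p.toReal < q.toReal := (ENNReal.toReal_lt_toReal (hpq.trans_le le_top).ne hq).mpr hpq
    exact sub_pos.mpr (one_div_lt_one_div_of_lt h1 h2)
  have hlim : Tendsto (fun δ : ℝ => B * ENNReal.ofReal δ ^ θ) (𝓝 0) (𝓝 0) := by
    have h1 : Tendsto (fun δ : ℝ => ENNReal.ofReal δ ^ θ) (𝓝 0) (𝓝 0) := by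
      have h2 := ((ENNReal.continuous_rpow_const (y := θ)).comp ENNReal.continuous_ofReal).tendsto 0
      simpa [ENNReal.zero_rpow_of_pos hθ0, Function.comp_def] using h2
    have h3 := ENNReal.Tendsto.const_mul h1 (Or.inr hB)
    simpa using h3
  have hev : ∀ᶠ δ in 𝓝[>] (0 : ℝ), B * ENNReal.ofReal δ ^ θ ≤ ENNReal.ofReal ε :=
    ((hlim.mono_left nhdsWithin_le_nhds).eventually_le_const (ENNReal.ofReal_pos.mpr hε))
  obtain ⟨δ, hδ, hδ0⟩ := (hev.and self_mem_nhdsWithin).exists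
  refine ⟨δ, hδ0, fun n s hs hPs => ?_⟩
  rw [eLpNorm_indicator_eq_eLpNorm_restrict hs]
  calc eLpNorm (f n) p (P.restrict s)
      ≤ eLpNorm (f n) q (P.restrict s) * P.restrict s Set.univ ^ θ :=
        eLpNorm_le_eLpNorm_mul_rpow_measure_univ hpq.le (hf n).restrict
    _ ≤ B * ENNReal.ofReal δ ^ θ := by
        rw [Measure.restrict_apply_univ]
        gcongr
        exact (eLpNorm_restrict_le _ _ _ _).trans (h n)
    _ ≤ ENNReal.ofReal ε := hδ

theorem eLpNorm_le_of_integral_pow_le {f : Ω → ℝ} {r : ℕ} {e : ℝ}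
    (hf : MemLp f ((2 * r + 2 : ℕ) : ℝ≥0∞) P) (h : ∫ ω, f ω ^ (2 * r + 2) ∂P ≤ e) :
    eLpNorm f ((2 * r + 2 : ℕ) : ℝ≥0∞) P ≤
      ENNReal.ofReal (e ^ (((2 * r + 2 : ℕ) : ℝ)⁻¹)) := by
  have hev : Even (2 * r + 2) := (even_two_mul r).add even_two
  rw [hf.eLpNorm_eq_integral_rpow_norm (by positivity) (ENNReal.natCast_ne_top _)]
  rw [ENNReal.toReal_natCast]
  refine ENNReal.ofReal_le_ofReal (Real.rpow_le_rpow ?_ ?_ (by positivity))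
  · exact integral_nonneg fun ω => by positivity
  · refine le_trans (le_of_eq ?_) h
    refine integral_congr_ae (ae_of_all _ fun ω => ?_)
    simp only [Real.rpow_natCast, Real.norm_eq_abs]
    exact hev.pow_abs _

theorem exists_even_exponent {p : ℝ≥0∞} (hp : p ≠ ∞) : ∃ r : ℕ, p ≤ ((2 * r + 2 : ℕ) : ℝ≥0∞) := by
  obtain ⟨n, hn⟩ := ENNReal.exists_nat_gt hp
  exact ⟨n, hn.le.trans (by exact_mod_cast (by omega : n ≤ 2 * n + 2))⟩

end Lp

/-! ### Pathwise consequences for a good code -/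

section Deterministic

variable {j : TreeCode} {x : ℕ → ℝ}

theorem IsGoodCode.root (hg : IsGoodCode j x) : x 0 = 1 := by
  refine tendsto_nhds_unique (hg.tendsto 0) (tendsto_const_nhds.congr fun m => ?_)
  rw [subtreeSize_root]
  push_cast
  rw [div_self (by positivity)]

theorem IsGoodCode.tendsto_fraction (hg : IsGoodCode j x) (i : ℕ) :
    Tendsto (fun n => ((subtree (harrisTree j n) (nodeWord j i)).card : ℝ) /
      ((harrisTree j n).card : ℝ)) atTop (𝓝 (x i)) := by
  rw [← tendsto_add_atTop_iff_nat 1]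
  refine (hg.tendsto i).congr fun m => ?_
  rw [card_subtree_harrisTree, card_harrisTree]
  push_cast
  rfl

theorem IsGoodCode.exists_index (hg : IsGoodCode j x) : ∃ idx : Node → ℕ,
    ∀ u, nodeWord j (idx u) = u :=
  ⟨_, Function.surjInv_eq (nodeWord_surjective hg.infinite)⟩

theorem index_nodeWord {idx : Node → ℕ} (hidx : ∀ u, nodeWord j (idx u) = u) (i : ℕ) :
    idx (nodeWord j i) = i := nodeWord_injective j (hidx _)

theorem IsGoodCode.exists_tendstoDoobMartin (hg : IsGoodCode j x) :
    ∃ μ : ProbabilityMeasure NodeBar, TendstoDoobMartin (fun n => harrisTree j n) μ := by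
  obtain ⟨idx, hidx⟩ := hg.exists_index
  obtain ⟨μ, hμ⟩ := exists_probabilityMeasure_cyl (y := fun u => x (idx u))
    (by rw [← nodeWord_zero (j := j), index_nodeWord hidx, hg.root]) (fun u => hg.pos _)
    (fun u => by
      have := hasSum_children_word hidx x (idx u) (hg.hasSum (idx u))
      rwa [hidx] at this)
  refine ⟨μ, fun u => ?_⟩
  rw [hμ]
  have := hg.tendsto_fraction (idx u)
  rwa [hidx] at this

variable {μ : ProbabilityMeasure NodeBar}

/-- Doob–Martin limits have prescribed masses, so every version of the limit can be treated alike.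
-/
theorem IsGoodCode.mass_eq (hg : IsGoodCode j x)
    (hμ : TendstoDoobMartin (fun n => harrisTree j n) μ) (i : ℕ) :
    (μ : Measure NodeBar).real (cyl (nodeWord j i)) = x i :=
  tendsto_nhds_unique (hμ _) (hg.tendsto_fraction i)

theorem IsGoodCode.hasSum_mass (hg : IsGoodCode j x)
    (hμ : TendstoDoobMartin (fun n => harrisTree j n) μ) (f : ℝ → ℝ) (v : ℕ) {z : ℝ}
    (hz : HasSum (fun l => if (j l : ℕ) = v then f (x (l + 1)) else 0) z) :
    HasSum (fun i : ℕ+ => f ((μ : Measure NodeBar).real (cyl (nodeWord j v ++ [i])))) z := by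
  obtain ⟨idx, hidx⟩ := hg.exists_index
  refine (hasSum_children_word hidx (fun i => f (x i)) v hz).congr_fun fun i => ?_
  rw [← hg.mass_eq hμ, hidx]

theorem IsGoodCode.isAtomFreeDiffuse (hg : IsGoodCode j x)
    (hμ : TendstoDoobMartin (fun n => harrisTree j n) μ) : IsAtomFreeDiffuse μ := by
  intro u
  obtain ⟨i, rfl⟩ := nodeWord_surjective hg.infinite u
  refine ⟨measure_fin_eq_zero μ _ ?_, ?_⟩
  · rw [hg.mass_eq hμ]
    exact hg.hasSum_mass hμ id i (hg.hasSum i)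
  · have h := hg.pos i
    rw [← hg.mass_eq hμ] at h
    exact pos_iff_ne_zero.mpr fun h0 => h.ne' (by rw [Measure.real, h0, ENNReal.toReal_zero])

/-- With `ρ_i = x_c / x_v`, expand `log ρ_i = log x_c - log x_v` and use that the masses `x_c` sum
to `x_v`. -/
theorem IsGoodCode.hasSum_rho (hg : IsGoodCode j x)
    (hμ : TendstoDoobMartin (fun n => harrisTree j n) μ) (v : ℕ) {z : ℝ}
    (hz : HasSum (fun l => if (j l : ℕ) = v then x (l + 1) * Real.log (x (l + 1)) else 0) z) :
    HasSum (fun i : ℕ+ => rho μ (nodeWord j v) i * Real.log (rho μ (nodeWord j v) i))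
      (z / x v - Real.log (x v)) := by
  have hv := hg.pos v
  have h1 := (hg.hasSum_mass hμ (fun s => s * Real.log s) v hz).div_const (x v)
  have h2 := (hg.hasSum_mass hμ id v (hg.hasSum v)).mul_right (Real.log (x v) / x v)
  have h3 := h1.sub h2
  rw [mul_div_cancel₀ _ hv.ne'] at h3
  refine h3.congr_fun fun i => ?_
  obtain ⟨k, hk⟩ := nodeWord_surjective hg.infinite (nodeWord j v ++ [i])
  have hk0 := hg.pos k
  simp only [rho, id]
  rw [← hk, hg.mass_eq hμ, hg.mass_eq hμ, Real.log_div hk0.ne' hv.ne']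
  field_simp

theorem IsGoodCode.summable_rho (hg : IsGoodCode j x)
    (hμ : TendstoDoobMartin (fun n => harrisTree j n) μ) (u : Node) :
    Summable fun i : ℕ+ => rho μ u i * Real.log (rho μ u i) := by
  obtain ⟨v, rfl⟩ := nodeWord_surjective hg.infinite u
  obtain ⟨z, hz, -⟩ := hg.nodeTerm v
  exact (hg.hasSum_rho hμ v hz).summable

theorem IsGoodCode.tendsto_nodeTerm (hg : IsGoodCode j x)
    (hμ : TendstoDoobMartin (fun n => harrisTree j n) μ) (v : ℕ) :
    Tendsto (fun m : ℕ => RecursiveTree.nodeTerm j v m / ((m : ℝ) + 1)) atTop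
      (𝓝 ((μ : Measure NodeBar).real (cyl (nodeWord j v)) * entropyC (rho μ (nodeWord j v)))) := by
  obtain ⟨z, hz, h⟩ := hg.nodeTerm v
  have hv := hg.pos v
  rw [entropyC, (hg.hasSum_rho hμ v hz).tsum_eq, hg.mass_eq hμ]
  have : x v * (1 + (z / x v - Real.log (x v))) = x v - x v * Real.log (x v) + z := by
    field_simp
    ring
  rwa [this]

/-- The difference of the two outer sums only involves words with `|u|₁ ≤ k`. These are finitely
many, so termwise limits suffice. -/
theorem IsGoodCode.tendsto_partialSum (hg : IsGoodCode j x)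
    (hμ : TendstoDoobMartin (fun n => harrisTree j n) μ) (k : ℕ) :
    Tendsto (fun m : ℕ => outerSum ∅ m j / ((m : ℝ) + 1) -
      outerSum {u | l1norm u ≤ k} m j / ((m : ℝ) + 1)) atTop (𝓝 (partialSum μ k)) := by
  obtain ⟨idx, hidx⟩ := hg.exists_index
  have h1 : Tendsto (fun m : ℕ => ∑ u ∈ nodesUpTo k,
      RecursiveTree.nodeTerm j (idx u) m / ((m : ℝ) + 1)) atTop (𝓝 (partialSum μ k)) := by
    refine tendsto_finsetSum _ fun u _ => ?_
    have := hg.tendsto_nodeTerm hμ (idx u)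
    rwa [hidx] at this
  refine h1.congr' ?_
  -- From this time on all words with `|u|₁ ≤ k` are present.
  filter_upwards [eventually_ge_atTop ((nodesUpTo k).sup idx)] with m hm
  rw [← sub_div, ← Finset.sum_div, outerSum, outerSum, ← Finset.sum_sub_distrib]
  congr 1
  classical
  have h2 : (nodesUpTo k).image idx =
      (Finset.range (m + 1)).filter fun v => l1norm (nodeWord j v) ≤ k := by
    ext v
    simp only [Finset.mem_image, Finset.mem_filter, Finset.mem_range, nodesUpTo,
      Set.Finite.mem_toFinset, Set.mem_ofPred_eq]
    constructor
    · rintro ⟨u, hu, rfl⟩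
      have h3 : idx u ≤ (nodesUpTo k).sup idx :=
        Finset.le_sup (f := idx) (by simpa [nodesUpTo] using hu)
      exact ⟨by omega, by rwa [hidx]⟩
    · rintro ⟨-, hv⟩
      exact ⟨nodeWord j v, hv, index_nodeWord hidx v⟩
  have hinj : Function.Injective idx := fun u w h => by rw [← hidx u, h, hidx w]
  rw [← Finset.sum_image (f := fun v => RecursiveTree.nodeTerm j v m)
    (fun _ _ _ _ h => hinj h), h2, Finset.sum_filter]
  refine Finset.sum_congr rfl fun v _ => ?_
  by_cases h : l1norm (nodeWord j v) ≤ k <;> simp [h]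

end Deterministic

/-! ### The limit tree as a random measure -/

section

variable {Ω : Type*} [MeasurableSpace Ω] {P : Measure Ω} [IsProbabilityMeasure P]
  {J : ∀ k : ℕ, Ω → Fin (k + 1)}

theorem harrisTree_dependsOnPast (n : ℕ) : DependsOnPast n fun j => harrisTree j n := by
  intro j j' h
  simp only [harrisTree]
  refine Finset.image_congr fun k hk => ?_
  exact nodeWord_congr fun l hl => h l (hl.trans (Finset.mem_range.mp (by simpa using hk)))

/-- The limit of the Harris chain exists as a random probability measure. -/
theorem exists_doobMartin_limit (hJ : IsRandomRecursive P J) :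
    ∃ Xinf : Ω → ProbabilityMeasure NodeBar,
      (∀ u : Node, Measurable fun ω => (Xinf ω : Measure NodeBar).real (cyl u)) ∧
      ∀ᵐ ω ∂P, TendstoDoobMartin (fun n => harrisChain J n ω) (Xinf ω) := by
  classical
  have hae : ∀ᵐ ω ∂P, ∃ μ, TendstoDoobMartin (fun n => harrisChain J n ω) μ := by
    filter_upwards [ae_isGoodCode hJ] with ω ⟨x, hx⟩
    exact hx.exists_tendstoDoobMartin
  -- The exceptional set is enlarged to a measurable null set. Off it the masses are limits of
  -- measurable fractions, whatever limit measure is chosen; on it a fixed measure is used.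
  obtain ⟨N, hsub, hNm, hN⟩ := exists_measurable_superset_of_null (ae_iff.mp hae)
  have hex : ∀ ω ∈ Nᶜ, ∃ μ, TendstoDoobMartin (fun n => harrisChain J n ω) μ := fun ω hω => by
    by_contra h
    exact hω (hsub h)
  let μ₀ : ProbabilityMeasure NodeBar := ⟨Measure.dirac (NodeBar.fin []), inferInstance⟩
  let X : Ω → ProbabilityMeasure NodeBar := fun ω => if h : ω ∈ Nᶜ then (hex ω h).choose else μ₀
  have hX : ∀ ω ∈ Nᶜ, TendstoDoobMartin (fun n => harrisChain J n ω) (X ω) := fun ω hω => by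
    simp only [X, dif_pos hω]
    exact (hex ω hω).choose_spec
  refine ⟨X, fun u => ?_, ?_⟩
  · have hm : ∀ n, Measurable fun ω => if ω ∈ Nᶜ then
        ((subtree (harrisChain J n ω) u).card : ℝ) / ((harrisChain J n ω).card : ℝ)
        else (μ₀ : Measure NodeBar).real (cyl u) := fun n => by
      have hd : DependsOnPast n fun j =>
          ((subtree (harrisTree j n) u).card : ℝ) / ((harrisTree j n).card : ℝ) := by
        intro j j' h
        have := harrisTree_dependsOnPast n j j' h
        simp only at this ⊢
        rw [this]
      exact Measurable.ite hNm.compl (hd.measurable hJ) measurable_const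
    refine measurable_of_tendsto_metrizable hm (tendsto_pi_nhds.mpr fun ω => ?_)
    by_cases hω : ω ∈ Nᶜ
    · simp only [if_pos hω]
      exact hX ω hω u
    · simp only [if_neg hω, X, dif_neg hω]
      exact tendsto_const_nhds
  · have : ∀ᵐ ω ∂P, ω ∈ Nᶜ := by rw [ae_iff]; simpa using hN
    filter_upwards [this] with ω hω
    exact hX ω hω

end

/-! ### The limit of the total path length -/

section

variable {Ω : Type*} [MeasurableSpace Ω] {P : Measure Ω} [IsProbabilityMeasure P]
  {J : ∀ k : ℕ, Ω → Fin (k + 1)}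

/-- The normalized outer sum. -/
noncomputable def outerMean (t : Set Node) (m : ℕ) (j : TreeCode) : ℝ :=
  outerSum t m j / ((m : ℝ) + 1)

theorem outerMean_dependsOnPast (t : Set Node) (m : ℕ) : DependsOnPast m (outerMean t m) :=
  fun j j' h => by rw [outerMean, outerMean, outerSum_congr t h]

theorem stepAvg_outerMean (t : Set Node) (m : ℕ) (j : TreeCode) :
    stepAvg m (outerMean t (m + 1)) j = outerMean t m j := by
  rw [outerMean, ← stepAvg_outerSum_div]
  congr 1
  funext j
  rw [outerMean]
  push_cast
  ring

theorem outerSum_zero (t : Set Node) (j : TreeCode) : outerSum t 0 j = 0 := by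
  simp [outerSum, nodeTerm_self]

theorem integral_outerMean (hJ : IsRandomRecursive P J) (t : Set Node) (m : ℕ) :
    ∫ ω, outerMean t m (code J ω) ∂P = 0 := by
  induction m with
  | zero => simp [outerMean, outerSum_zero]
  | succ m ih =>
    rw [integral_stepAvg hJ (outerMean_dependsOnPast t (m + 1))]
    simp_rw [stepAvg_outerMean]
    exact ih

/-- The `L^p` seminorms of the outer means are small if these vanish up to a late time. -/
theorem exists_eLpNorm_outerMean_le (hJ : IsRandomRecursive P J) (r : ℕ) :
    ∃ δ : ℕ → ℝ≥0∞, Tendsto δ atTop (𝓝 0) ∧ (∀ k, δ k ≠ ∞) ∧ ∀ (t : Set Node) (k : ℕ),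
      (∀ m ≤ k, ∀ j, outerSum t m j = 0) → ∀ m,
      eLpNorm (fun ω => outerMean t m (code J ω)) ((2 * r + 2 : ℕ) : ℝ≥0∞) P ≤ δ k := by
  obtain ⟨ε, hε, h⟩ := exists_integral_outerSum_pow_le hJ r
  refine ⟨fun k => ENNReal.ofReal (ε k ^ (((2 * r + 2 : ℕ) : ℝ)⁻¹)), ?_,
    fun k => ENNReal.ofReal_ne_top, fun t k h0 m => ?_⟩
  · have hpos : (0 : ℝ) < ((2 * r + 2 : ℕ) : ℝ)⁻¹ := by positivity
    have h1 := hε.rpow_const (p := ((2 * r + 2 : ℕ) : ℝ)⁻¹) (Or.inr hpos.le)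
    rw [Real.zero_rpow hpos.ne'] at h1
    have h2 := (ENNReal.continuous_ofReal.tendsto 0).comp h1
    rwa [ENNReal.ofReal_zero] at h2
  · exact eLpNorm_le_of_integral_pow_le ((outerMean_dependsOnPast t m).memLp hJ _) (h t k h0 m)

/-- A martingale bounded in `L²`, hence in `L¹` by `|x| ≤ 1 + x ^ 2`. -/
theorem ae_tendsto_outerMean (hJ : IsRandomRecursive P J) (t : Set Node) :
    ∀ᵐ ω ∂P, ∃ c, Tendsto (fun m => outerMean t m (code J ω)) atTop (𝓝 c) := by
  obtain ⟨ε, -, h⟩ := exists_integral_outerSum_pow_le hJ 0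
  refine ae_tendsto_of_le_stepAvg hJ (m₀ := 0) (outerMean_dependsOnPast t)
    (fun m _ j => (stepAvg_outerMean t m j).ge) (C := 1 + ε 0) fun m _ => ?_
  have hd2 : DependsOnPast m fun j => outerMean t m j ^ 2 := fun j j' hj => by
    simp only
    rw [outerMean_dependsOnPast t m j j' hj]
  have hi := hd2.integrable hJ
  calc ∫ ω, |outerMean t m (code J ω)| ∂P
      ≤ ∫ ω, (1 + outerMean t m (code J ω) ^ 2) ∂P := by
        refine integral_mono ((outerMean_dependsOnPast t m).integrable hJ).abs
          ((integrable_const 1).add hi) fun ω => ?_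
        simp only
        rw [← sq_abs]
        nlinarith [sq_nonneg (|outerMean t m (code J ω)| - 1), abs_nonneg (outerMean t m (code J ω))]
    _ = 1 + ∫ ω, outerMean t m (code J ω) ^ 2 ∂P := by
        rw [integral_add (integrable_const 1) hi]
        simp
    _ ≤ 1 + ε 0 := by
        have := h t 0 (fun m hm j => by rw [Nat.le_zero.mp hm, outerSum_zero]) m
        simp only [mul_zero, zero_add] at this
        simp only [outerMean]
        linarith

/-- The centred and normalized total path length as an outer mean. -/
theorem outerMean_empty (m : ℕ) (ω : Ω) :
    (1 / ((m + 1 : ℕ) : ℝ)) * (totalPathLength (harrisChain J (m + 1) ω) : ℝ) -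
      (harmonic (m + 1) : ℝ) + 1 = outerMean ∅ m (code J ω) := by
  have h : (totalPathLength (harrisChain J (m + 1) ω) : ℝ) =
      ∑ k ∈ Finset.range (m + 1), (depth (code J ω) k : ℝ) := by
    exact_mod_cast totalPathLength_harrisTree (code J ω) (m + 1)
  rw [outerMean, outerSum_empty, h, harm]
  push_cast
  field_simp

theorem totalPathLength_dependsOnPast (n : ℕ) :
    DependsOnPast n fun j => (totalPathLength (harrisTree j n) : ℝ) := by
  intro j j' h
  have := harrisTree_dependsOnPast n j j' h
  simp only at this ⊢
  rw [this]

theorem integral_totalPathLength (hJ : IsRandomRecursive P J) {n : ℕ} (hn : 1 ≤ n) :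
    ∫ ω, (totalPathLength (harrisChain J n ω) : ℝ) ∂P =
      (n : ℝ) * (harmonic n : ℝ) - (n : ℝ) := by
  obtain ⟨m, rfl⟩ := Nat.exists_eq_add_of_le' hn
  have h : ∀ ω, (totalPathLength (harrisChain J (m + 1) ω) : ℝ) =
      ((m : ℝ) + 1) * outerMean ∅ m (code J ω) +
        (((m : ℝ) + 1) * (harmonic (m + 1) : ℝ) - ((m : ℝ) + 1)) := by
    intro ω
    rw [← outerMean_empty]
    push_cast
    field_simp
    ring
  simp_rw [h]
  rw [integral_add (((outerMean_dependsOnPast ∅ m).integrable hJ).const_mul _)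
    (integrable_const _), integral_const_mul, integral_outerMean hJ]
  simp

/-- The almost sure limit of the normalized total path length, and its approximation by the partial
sums of the series. -/
theorem exists_limit_of_tendstoDoobMartin (hJ : IsRandomRecursive P J)
    (Xinf : Ω → ProbabilityMeasure NodeBar)
    (hX : ∀ᵐ ω ∂P, TendstoDoobMartin (fun n => harrisChain J n ω) (Xinf ω)) :
    ∃ Yinf : Ω → ℝ,
      (∀ p : ℝ≥0∞, 0 < p → p ≠ ∞ →
        MemLp Yinf p P ∧ (∀ k : ℕ, MemLp (fun ω => partialSum (Xinf ω) k) p P) ∧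
        Tendsto (fun k : ℕ => eLpNorm (fun ω => partialSum (Xinf ω) k - Yinf ω) p P)
          atTop (𝓝 0)) ∧
      (∀ᵐ ω ∂P, Tendsto (fun m => outerMean ∅ m (code J ω)) atTop (𝓝 (Yinf ω))) ∧
      (∀ p : ℝ≥0∞, 0 < p → p ≠ ∞ →
        Tendsto (fun m : ℕ => eLpNorm (fun ω => outerMean ∅ m (code J ω) - Yinf ω) p P)
          atTop (𝓝 0)) := by
  classical
  obtain ⟨Y, hY⟩ : ∃ Y : Ω → ℝ, ∀ᵐ ω ∂P,
      Tendsto (fun m => outerMean ∅ m (code J ω)) atTop (𝓝 (Y ω)) := by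
    refine ⟨fun ω => if h : ∃ c, Tendsto (fun m => outerMean ∅ m (code J ω)) atTop (𝓝 c)
      then h.choose else 0, ?_⟩
    filter_upwards [ae_tendsto_outerMean hJ ∅] with ω h
    rw [dif_pos h]
    exact h.choose_spec
  -- The words with `|u|₁ > k` account for what the partial sum leaves out of `Y`.
  have hS : ∀ k, ∀ᵐ ω ∂P, Tendsto (fun m => outerMean {u | l1norm u ≤ k} m (code J ω)) atTop
      (𝓝 (Y ω - partialSum (Xinf ω) k)) := by
    intro k
    filter_upwards [hY, hX, ae_isGoodCode hJ] with ω h1 h2 ⟨x, hx⟩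
    refine (h1.sub (hx.tendsto_partialSum h2 k)).congr fun m => ?_
    simp only [outerMean]
    ring
  have hmeas : ∀ t m, AEStronglyMeasurable (fun ω => outerMean t m (code J ω)) P := fun t m =>
    ((outerMean_dependsOnPast t m).measurable hJ).aestronglyMeasurable
  have hYm : AEStronglyMeasurable Y P :=
    aestronglyMeasurable_of_tendsto_ae atTop (hmeas ∅) hY
  -- No measurability of `Xinf` is assumed; it is inherited from the approximating outer means.
  have hSm : ∀ k, AEStronglyMeasurable (fun ω => Y ω - partialSum (Xinf ω) k) P := fun k =>
    aestronglyMeasurable_of_tendsto_ae atTop (hmeas _) (hS k)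
  -- Fatou's lemma: `L^q` bounds uniform in time pass to the almost sure limit.
  have hlim : ∀ {t : Set Node} {Z : Ω → ℝ} {q B : ℝ≥0∞},
      (∀ᵐ ω ∂P, Tendsto (fun m => outerMean t m (code J ω)) atTop (𝓝 (Z ω))) →
      (∀ m, eLpNorm (fun ω => outerMean t m (code J ω)) q P ≤ B) → eLpNorm Z q P ≤ B := by
    intro t Z q B h1 h2
    refine (Lp.eLpNorm_lim_le_liminf_eLpNorm (hmeas t) Z h1).trans ?_
    exact liminf_le_of_frequently_le' (Frequently.of_forall h2)
  have hYp : ∀ p : ℝ≥0∞, p ≠ ∞ → MemLp Y p P := by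
    intro p hp
    obtain ⟨r, hr⟩ := exists_even_exponent hp
    obtain ⟨δ, -, hδ, h⟩ := exists_eLpNorm_outerMean_le hJ r
    refine MemLp.mono_exponent ⟨hYm, ?_⟩ hr
    exact (hlim hY (h ∅ 0 fun m hm j => by rw [Nat.le_zero.mp hm, outerSum_zero])).trans_lt
      (hδ 0).lt_top
  have hDp : ∀ k, ∀ r : ℕ, ∀ δ : ℕ → ℝ≥0∞, (∀ (t : Set Node) (k : ℕ),
      (∀ m ≤ k, ∀ j, outerSum t m j = 0) → ∀ m,
      eLpNorm (fun ω => outerMean t m (code J ω)) ((2 * r + 2 : ℕ) : ℝ≥0∞) P ≤ δ k) →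
      eLpNorm (fun ω => Y ω - partialSum (Xinf ω) k) ((2 * r + 2 : ℕ) : ℝ≥0∞) P ≤ δ k :=
    fun k r δ h => hlim (hS k) (h _ k fun m hm j => outerSum_eq_zero hm)
  refine ⟨Y, fun p hp0 hp => ⟨hYp p hp, fun k => ?_, ?_⟩, hY, fun p hp0 hp => ?_⟩
  · obtain ⟨r, hr⟩ := exists_even_exponent hp
    obtain ⟨δ, -, hδ, h⟩ := exists_eLpNorm_outerMean_le hJ r
    have h1 : MemLp (fun ω => Y ω - partialSum (Xinf ω) k) p P :=
      MemLp.mono_exponent ⟨hSm k, (hDp k r δ h).trans_lt (hδ k).lt_top⟩ hr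
    have h2 := (hYp p hp).sub h1
    refine h2.ae_eq (ae_of_all _ fun ω => ?_)
    simp
  · obtain ⟨r, hr⟩ := exists_even_exponent hp
    obtain ⟨δ, hδ0, -, h⟩ := exists_eLpNorm_outerMean_le hJ r
    refine tendsto_of_tendsto_of_tendsto_of_le_of_le tendsto_const_nhds hδ0
      (fun _ => zero_le) fun k => ?_
    rw [show (fun ω => partialSum (Xinf ω) k - Y ω) =
      -fun ω => Y ω - partialSum (Xinf ω) k by ext ω; simp, eLpNorm_neg]
    exact (eLpNorm_le_eLpNorm_of_exponent_le hr (hSm k)).trans (hDp k r δ h)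
  · obtain ⟨r, hr⟩ := exists_even_exponent hp
    -- The next even exponent is used, so that bounded moments give uniform integrability at
    -- exponent `2r + 2`.
    obtain ⟨δ, -, hδ, h⟩ := exists_eLpNorm_outerMean_le hJ (r + 1)
    have hq : ((2 * r + 2 : ℕ) : ℝ≥0∞) ≠ ∞ := ENNReal.natCast_ne_top _
    have hui := unifIntegrable_of_eLpNorm_le (P := P)
      (f := fun m ω => outerMean ∅ m (code J ω)) (p := ((2 * r + 2 : ℕ) : ℝ≥0∞))
      (q := ((2 * (r + 1) + 2 : ℕ) : ℝ≥0∞)) (by simp)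
      (by exact_mod_cast (by omega : 2 * r + 2 < 2 * (r + 1) + 2)) (ENNReal.natCast_ne_top _)
      (hmeas ∅) (hδ 0) (h ∅ 0 fun m hm j => by rw [Nat.le_zero.mp hm, outerSum_zero])
    have h1 := tendsto_Lp_finite_of_tendsto_ae
      (by exact_mod_cast (by omega : 1 ≤ 2 * r + 2)) hq (hmeas ∅) (hYp _ hq) hui hY
    refine tendsto_of_tendsto_of_tendsto_of_le_of_le tendsto_const_nhds h1
      (fun _ => zero_le) fun m => ?_
    exact eLpNorm_le_eLpNorm_of_exponent_le hr ((hmeas ∅ m).sub hYm)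

end

end RecursiveTree

theorem theorem6 {Ω : Type*} [MeasurableSpace Ω] (P : Measure Ω) [IsProbabilityMeasure P]
    (J : ∀ k : ℕ, Ω → Fin (k + 1)) (hJ : IsRandomRecursive P J) :
    -- the limit tree exists as a random probability measure
    (∃ Xinf : Ω → ProbabilityMeasure NodeBar,
      (∀ u : Node, Measurable fun ω => (Xinf ω : Measure NodeBar).real (cyl u)) ∧
      ∀ᵐ ω ∂P, TendstoDoobMartin (fun n => harrisChain J n ω) (Xinf ω)) ∧
    -- for every version of the limit tree
    (∀ Xinf : Ω → ProbabilityMeasure NodeBar,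
      (∀ᵐ ω ∂P, TendstoDoobMartin (fun n => harrisChain J n ω) (Xinf ω)) →
      -- the terms of the series are well defined
      (∀ᵐ ω ∂P, IsAtomFreeDiffuse (Xinf ω) ∧
        ∀ u : Node, Summable fun i : ℕ+ => rho (Xinf ω) u i * Real.log (rho (Xinf ω) u i)) ∧
      ∃ Yinf : Ω → ℝ,
        -- `Yinf` is the sum of the series, as a limit of partial sums in every `L^p`
        (∀ p : ℝ≥0∞, 0 < p → p ≠ ∞ →
          MemLp Yinf p P ∧ (∀ k : ℕ, MemLp (fun ω => partialSum (Xinf ω) k) p P) ∧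
          Tendsto (fun k : ℕ => eLpNorm (fun ω => partialSum (Xinf ω) k - Yinf ω) p P)
            atTop (𝓝 0)) ∧
        -- almost sure convergence
        (∀ᵐ ω ∂P, Tendsto
          (fun n : ℕ => (1 / (n : ℝ)) * (totalPathLength (harrisChain J n ω) : ℝ)
            - (harmonic n : ℝ) + 1) atTop (𝓝 (Yinf ω))) ∧
        -- convergence in `L^p` for all `p > 0`
        (∀ p : ℝ≥0∞, 0 < p → p ≠ ∞ →
          (∀ n : ℕ, MemLp (fun ω => (totalPathLength (harrisChain J n ω) : ℝ)) p P) ∧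
          Tendsto (fun n : ℕ => eLpNorm
            (fun ω => (1 / (n : ℝ)) * (totalPathLength (harrisChain J n ω) : ℝ)
              - (harmonic n : ℝ) + 1 - Yinf ω) p P) atTop (𝓝 0))) ∧
    -- the mean of the total path length
    (∀ n : ℕ, 1 ≤ n →
      Integrable (fun ω => (totalPathLength (harrisChain J n ω) : ℝ)) P ∧
      ∫ ω, (totalPathLength (harrisChain J n ω) : ℝ) ∂P = (n : ℝ) * (harmonic n : ℝ) - (n : ℝ)) := by
  -- The tree with `n` nodes corresponds to the outer mean with index `m = n - 1`.
  have hshift : ∀ {β : Type} (f : ℕ → β) (l : Filter β),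
      Tendsto (fun m => f (m + 1)) atTop l → Tendsto f atTop l := fun f l =>
    (tendsto_add_atTop_iff_nat 1).mp
  refine ⟨RecursiveTree.exists_doobMartin_limit hJ, fun Xinf hX => ⟨?_, ?_⟩, fun n hn =>
    ⟨(RecursiveTree.totalPathLength_dependsOnPast n).integrable hJ,
      RecursiveTree.integral_totalPathLength hJ hn⟩⟩
  · filter_upwards [hX, RecursiveTree.ae_isGoodCode hJ] with ω h ⟨x, hx⟩
    exact ⟨hx.isAtomFreeDiffuse h, hx.summable_rho h⟩
  · obtain ⟨Y, h1, h2, h3⟩ := RecursiveTree.exists_limit_of_tendstoDoobMartin hJ Xinf hX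
    refine ⟨Y, h1, ?_, fun p hp0 hp => ⟨fun n =>
      (RecursiveTree.totalPathLength_dependsOnPast n).memLp hJ p, ?_⟩⟩
    · filter_upwards [h2] with ω hω
      refine hshift _ _ (hω.congr fun m => ?_)
      rw [RecursiveTree.outerMean_empty]
    · refine hshift _ _ ((h3 p hp0 hp).congr fun m => ?_)
      congr 1
      funext ω
      rw [RecursiveTree.outerMean_empty]
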